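/- **Model.** There are $N\ge 1$ points of interest (PoIs) and time slots $t=0,1,2,\dots$. In slot $t$, $A[t]\in\{0,1,2,\dots\}$ users arrive, and PoI $n$ can serve $R_n[t]\in\{0,1,2,\dots\}$ users. The $A[t]$ are i.i.d. with mean $\lambda>0$ and $\mathbb E[A^2[t]]<\infty$. For each $n$ the $R_n[t]$ are i.i.d. in $t$ with mean $\mu_n>0$ and satisfy $R_n[t]\le R_{\max}$. In each slot, arrivals and services are mutually independent, and they are jointly independent of the past (all arrivals, services and prices of earlier slots, the initial state, and any randomness used in decisions so far). PoI $n$ has a price $p_n[t]\in[p_{\min},p_{\max}]$ with $p_{\min}>0$. All users arriving in slot $t$ go to one PoI $n[t]$, and with $S_n[t]=\mathbf 1\{n[t]=n\}$ the queue lengths, ages and recorded prices evolve as $$Q_n[t+1]=\max\{Q_n[t]+A[t]S_n[t]-R_n[t],\,0\},$$ $\Delta_n[t+1]=0$ and $r_n[t+1]=p_n[t]$ if $S_n[t]\mathbf 1\{A[t]>0\}=1$, and $\Delta_n[t+1]=\Delta_n[t]+1$ and $r_n[t+1]=r_n[t]$ otherwise. The initial state consists of $Q_n[0],\Delta_n[0]\in\{0,1,2,\dots\}$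 with $\mathbb E[Q_n^2[0]]<\infty$, $\mathbb E[\Delta_n[0]]<\infty$, and $r_n[0]\in[p_{\min},p_{\max}]$. For $\beta,\gamma>0$, *selfish behaviour* means that in every slot $$n[t]\in\arg\max_{n}\big(\beta\Delta_n[t]-\gamma Q_n[t]-r_n[t]\big),$$ where $n[t]$ (including the tie-breaking) depends only on information available before slot $t$. Put $\mu_\Sigma=\sum_n\mu_n$, $\mu_{\max}=\max_n\mu_n$, $q=\Pr\{A[t]>0\}$. For $\epsilon>0$ the cost of a policy is $$J=\limsup_{T\to\infty}\frac1T\sum_{t=0}^{T-1}\Big[\frac{\gamma\epsilon}{N}\sum_{n=1}^N\mathbb E[Q_n[t]]+\beta\sum_{n=1}^N\frac{\mu_n}{\mu_\Sigma}\mathbb E[\Delta_n[t]]\Big].$$ $J(\beta,\gamma)$ is the cost under selfish behaviour, $J^{(\mathrm{OPT})}(\beta,\gamma)$ is the infimum of the costs of all causal policies (those whose choice $n[t]$ is determined by the past and $A[t]$), and the price of anarchy is $\rho(\beta,\gamma)=1-J^{(\mathrm{OPT})}(\beta,\gamma)/J(\beta,\gamma)$. **Theorem.** Suppose $\lambda<\mu_\Sigma$.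 Then there exists $\epsilon>0$ with $\mu_n/\lambda\ge\mu_n/\mu_\Sigma+\epsilon/N$ for all $n$. For every such $\epsilon$ and all $\beta,\gamma>0$, every selfish behaviour has $J(\beta,\gamma)<\infty$, one has $J(\beta,\gamma)>0$ unless $N=q=1$, and (with the convention $0/0=0$) $$\rho(\beta,\gamma)\le\frac{B(\gamma)-\gamma M+p_{\max}}{B(\gamma)+\beta\left(\frac Nq-1\right)+p_{\max}}+\frac{\beta\left(\frac Nq-\frac1{2q\mu_{\max}}\sum_{n=1}^N\mu_n-\frac12\right)}{B(\gamma)+\beta\left(\frac Nq-1\right)+p_{\max}},$$ where $$B(\gamma)=\frac{\gamma}{2\lambda}\Big(\mathbb E[A^2[t]]+\sum_{n=1}^N\mathbb E[R_n^2[t]]\Big),$$ $$M=\frac{\epsilon}{2N(\mu_\Sigma-\lambda)}\Big(\mathrm{Var}(A[t])+\sum_{n=1}^N\mathrm{Var}(R_n[t])+(\mu_\Sigma-\lambda)^2\Big)-\frac12\epsilon R_{\max}.$$ Moreover, if $\mu_1=\dots=\mu_N$ and it is not the case that $N=q=1$, then for fixed $\gamma$ and $\epsilon$ the right-hand side of this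 bound tends to $1/2$ as $\beta\to\infty$. -/

import Mathlib

open MeasureTheory ProbabilityTheory Filter Topology
open scoped ENNReal

/-- The primitive random data of a mobile crowd-learning system with `N` points of interest (PoIs)
in slotted time, on a sample space `Ω`. -/
structure CrowdSystem (N : ℕ) (Ω : Type*) where
  /-- `A t` is the number of users arriving in slot `t`. -/
  A : ℕ → Ω → ℕ
  /-- `R t n` is the number of users that PoI `n` can serve in slot `t`. -/
  R : ℕ → Fin N → Ω → ℕ
  /-- `p t n` is the price (the true state) of PoI `n` in slot `t`. -/
  p : ℕ → Fin N → Ω → ℝ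
  /-- Initial queue lengths. -/
  Q₀ : Fin N → Ω → ℕ
  /-- Initial ages. -/
  Δ₀ : Fin N → Ω → ℕ
  /-- Initial recorded prices. -/
  r₀ : Fin N → Ω → ℝ

namespace CrowdSystem

variable {N : ℕ} {Ω : Type*}

section Dynamics

variable (S : CrowdSystem N Ω) (D : ℕ → Ω → Fin N)

/-- Queue length of PoI `n` when the users of slot `t` go to PoI `D t`:
`Q n (t+1) = max (Q n t + A t * 1{D t = n} - R t n) 0`
(the subtraction of natural numbers is the truncated one). -/
def queue : ℕ → Fin N → Ω → ℕ
  | 0, n, ω => S.Q₀ n ω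
  | t + 1, n, ω => queue t n ω + (if D t ω = n then S.A t ω else 0) - S.R t n ω

/-- Age of the record of PoI `n`: reset to `0` when at least one user visits PoI `n`,
increased by one otherwise. -/
def age : ℕ → Fin N → Ω → ℕ
  | 0, n, ω => S.Δ₀ n ω
  | t + 1, n, ω => if D t ω = n ∧ 0 < S.A t ω then 0 else age t n ω + 1

/-- Recorded price of PoI `n`: users visiting PoI `n` in slot `t` report `p t n`. -/
def record : ℕ → Fin N → Ω → ℝ
  | 0, n, ω => S.r₀ n ω
  | t + 1, n, ω => if D t ω = n ∧ 0 < S.A t ω then S.p t n ω else record t n ω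

/-- Presumed benefit of a user choosing PoI `n` in slot `t`. -/
noncomputable def benefit (β γ : ℝ) (t : ℕ) (n : Fin N) (ω : Ω) : ℝ :=
  β * (S.age D t n ω : ℝ) - γ * (S.queue D t n ω : ℝ) - S.record D t n ω

end Dynamics

section Probability

variable [mΩ : MeasurableSpace Ω] (S : CrowdSystem N Ω) (P : Measure Ω)

/-- The mean arrival rate. -/
noncomputable def arrivalRate : ℝ := ∫ ω, (S.A 0 ω : ℝ) ∂P

/-- The mean service rate `μ n` of PoI `n`. -/
noncomputable def mu (n : Fin N) : ℝ := ∫ ω, (S.R 0 n ω : ℝ) ∂P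

/-- The total service rate. -/
noncomputable def muSum : ℝ := ∑ n, S.mu P n

/-- The largest service rate. -/
noncomputable def muMax : ℝ := ⨆ n, S.mu P n

/-- The probability that at least one user arrives in a slot. -/
noncomputable def q : ℝ := P.real {ω | 0 < S.A 0 ω}

/-- The standing assumptions. The σ-algebra `𝓕 t` is the information available at the beginning of
slot `t`; it contains the whole past. -/
structure IsModel (𝓕 : Filtration ℕ mΩ) (pmin pmax Rmax : ℝ) : Prop where
  /-- Arrivals, services and prices of slot `t` are part of the past at time `t + 1`. -/
  measurable_A : ∀ t, Measurable[𝓕 (t + 1)] (S.A t)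
  measurable_R : ∀ t n, Measurable[𝓕 (t + 1)] (S.R t n)
  measurable_p : ∀ t n, Measurable[𝓕 (t + 1)] (S.p t n)
  measurable_Q₀ : ∀ n, Measurable[𝓕 0] (S.Q₀ n)
  measurable_Δ₀ : ∀ n, Measurable[𝓕 0] (S.Δ₀ n)
  measurable_r₀ : ∀ n, Measurable[𝓕 0] (S.r₀ n)
  /-- Arrivals and services are identically distributed over time, independent of the past
  (hence independent across time), services are independent across PoIs, and arrivals are
  independent of services. -/
  identDistrib_A : ∀ t, IdentDistrib (S.A t) (S.A 0) P P
  identDistrib_R : ∀ t n, IdentDistrib (S.R t n) (S.R 0 n) P P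
  indep_past : ∀ t, Indep
    (MeasurableSpace.comap (fun ω => (S.A t ω, fun n => S.R t n ω)) inferInstance) (𝓕 t) P
  indep_R : ∀ t, iIndepFun (fun n => S.R t n) P
  indep_A_R : ∀ t, IndepFun (S.A t) (fun ω n => S.R t n ω) P
  /-- Moments and bounds. -/
  arrivalRate_pos : 0 < S.arrivalRate P
  sq_integrable_A : Integrable (fun ω => (S.A 0 ω : ℝ) ^ 2) P
  mu_pos : ∀ n, 0 < S.mu P n
  R_le : ∀ t n, ∀ᵐ ω ∂P, (S.R t n ω : ℝ) ≤ Rmax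
  pmin_pos : 0 < pmin
  p_mem : ∀ t n, ∀ᵐ ω ∂P, S.p t n ω ∈ Set.Icc pmin pmax
  r₀_mem : ∀ n, ∀ᵐ ω ∂P, S.r₀ n ω ∈ Set.Icc pmin pmax
  /-- The initial state has finite moments (for instance, it is deterministic). -/
  sq_integrable_Q₀ : ∀ n, Integrable (fun ω => (S.Q₀ n ω : ℝ) ^ 2) P
  integrable_Δ₀ : ∀ n, Integrable (fun ω => (S.Δ₀ n ω : ℝ)) P

/-- A causal policy: the PoI visited in slot `t` is selected from the past and the current number
of arrivals. -/
def IsPolicy (𝓕 : Filtration ℕ mΩ) (D : ℕ → Ω → Fin N) : Prop :=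
  ∀ t, Measurable[𝓕 t ⊔ MeasurableSpace.comap (S.A t) inferInstance] (D t)

/-- Selfish behaviour: the PoI visited in slot `t` maximises the presumed benefit, ties being broken
in any way that depends on the past only (possibly including private randomness). -/
def IsSelfish (𝓕 : Filtration ℕ mΩ) (β γ : ℝ) (D : ℕ → Ω → Fin N) : Prop :=
  (∀ t, Measurable[𝓕 t] (D t)) ∧
    ∀ t, ∀ᵐ ω ∂P, ∀ n, S.benefit D β γ t n ω ≤ S.benefit D β γ t (D t ω) ω

/-- Expected cost of slot `t`, in `[0, ∞]`:
`(γ ε / N) * ∑ E[Q n t] + β * ∑ (μ n / μ_Σ) * E[Δ n t]`. -/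
noncomputable def slotCost (β γ ε : ℝ) (D : ℕ → Ω → Fin N) (t : ℕ) : ℝ≥0∞ :=
  ENNReal.ofReal (γ * ε / N) * ∑ n, ∫⁻ ω, (S.queue D t n ω : ℝ≥0∞) ∂P +
    ENNReal.ofReal β *
      ∑ n, ENNReal.ofReal (S.mu P n / S.muSum P) * ∫⁻ ω, (S.age D t n ω : ℝ≥0∞) ∂P

/-- The long-run average cost `J` of a policy, in `[0, ∞]`. -/
noncomputable def cost (β γ ε : ℝ) (D : ℕ → Ω → Fin N) : ℝ≥0∞ :=
  limsup (fun T : ℕ => (∑ t ∈ Finset.range T, S.slotCost P β γ ε D t) / (T : ℝ≥0∞)) atTop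

/-- The optimal cost over all causal policies. -/
noncomputable def optCost (𝓕 : Filtration ℕ mΩ) (β γ ε : ℝ) : ℝ≥0∞ :=
  ⨅ (D : ℕ → Ω → Fin N) (_ : S.IsPolicy 𝓕 D), S.cost P β γ ε D

/-- The price of anarchy of the behaviour `D`. -/
noncomputable def poa (𝓕 : Filtration ℕ mΩ) (β γ ε : ℝ) (D : ℕ → Ω → Fin N) : ℝ :=
  1 - (S.optCost P 𝓕 β γ ε).toReal / (S.cost P β γ ε D).toReal

/-- `B(γ) = γ / (2 λ) * (E[A²] + ∑ E[R n ²])`. -/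
noncomputable def B (γ : ℝ) : ℝ :=
  γ / (2 * S.arrivalRate P) *
    (∫ ω, (S.A 0 ω : ℝ) ^ 2 ∂P + ∑ n, ∫ ω, (S.R 0 n ω : ℝ) ^ 2 ∂P)

/-- `M = ε / (2 N (μ_Σ - λ)) * (Var A + ∑ Var (R n) + (μ_Σ - λ)²) - ε Rmax / 2`. -/
noncomputable def M (ε Rmax : ℝ) : ℝ :=
  ε / (2 * N * (S.muSum P - S.arrivalRate P)) *
      (variance (fun ω => (S.A 0 ω : ℝ)) P + ∑ n, variance (fun ω => (S.R 0 n ω : ℝ)) P +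
        (S.muSum P - S.arrivalRate P) ^ 2) -
    1 / 2 * ε * Rmax

/-- The explicit bound on the price of anarchy. -/
noncomputable def poaBound (pmax Rmax ε γ β : ℝ) : ℝ :=
  (S.B P γ - γ * S.M P ε Rmax + pmax) / (S.B P γ + β * (N / S.q P - 1) + pmax) +
    β * (N / S.q P - 1 / (2 * S.q P * S.muMax P) * ∑ n, S.mu P n - 1 / 2) /
      (S.B P γ + β * (N / S.q P - 1) + pmax)

end Probability

end CrowdSystem

/-!
The upper bound on the cost of selfish behaviour is a drift argument. With arrivals independent of
the selected PoI `D t`, the Lyapunov function `γ / (2 λ) * ∑ E[Q n ²] + β / q * ∑ E[Δ n]` changes in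
slot `t` by at most
`B(γ) + β (N / q - 1) - E[β Δ_{D t} - γ Q_{D t}] - (γ / λ) * ∑ μ n E[Q n]`.
A selfish choice makes `β Δ_{D t} - γ Q_{D t}`, up to the price range, at least the average of
`β Δ n - γ Q n` with weights `μ n / μ_Σ`. By the choice of `ε` the drift is then at most
`B(γ) + β (N / q - 1) + pmax` minus the cost of the slot (`IsModel.meanCost_add_lyapunov_le`), and
summation over the slots bounds the cost by this constant (`IsModel.selfish_cost_le`).

The lower bound `γ M + β (μ_Σ / (2 q μ_max) - 1 / 2)` holds for every causal policy
(`IsModel.le_policy_cost`) and has two parts.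
* Ages. Along every sample path the ages of a PoI sum up to at least
  `(c - 1 / 2) T - c² / 2 * (number of visits) - c² / 2` for every real `c` (`le_sum_age`). A single
  constant `c = μ_Σ / (q μ_max)` for all PoIs gives the bound, since a slot has at most one visit,
  with probability at most `q`.
* Queues. The total queue length dominates the queue of one server that pools all services. Up to
  the unused service, which is at most `N Rmax`, the square of that queue has an exact drift, and
  its mean is the Kingman-type expression in `M`, provided the boundary term
  `E[(pooled queue)²] / T` vanishes. As arrivals have two moments only, they are truncated at a
  level `K`; then an exponential moment of the pooled queue stays bounded
  (`IsModel.exists_integral_pooledQueue_sq_le`), and `K → ∞` at the end.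

The bound on the price of anarchy is one minus the quotient of the two estimates.
-/

namespace CrowdSystem

variable {N : ℕ} {Ω : Type*} {S : CrowdSystem N Ω} {D : ℕ → Ω → Fin N}

/-! ### Sample paths -/

theorem age_le (t : ℕ) (n : Fin N) (ω : Ω) : S.age D t n ω ≤ S.Δ₀ n ω + t := by
  induction t with
  | zero => simp [age]
  | succ t ih => simp only [age]; split_ifs <;> omega

theorem sq_add_sub_le (x a r : ℕ) :
    ((x + a - r : ℕ) : ℝ) ^ 2 ≤ x ^ 2 + a ^ 2 + r ^ 2 + 2 * (x * a) - 2 * (x * r) := by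
  have h : (0 : ℝ) ≤ a * r := by positivity
  rcases le_total r (x + a) with hr | hr
  · push_cast [Nat.cast_sub hr]
    nlinarith
  · rw [Nat.sub_eq_zero_of_le hr]
    push_cast
    nlinarith [sq_nonneg ((x : ℝ) + a - r)]

/-- One-slot bound on the total squared queue length along a sample path. -/
theorem sum_queue_sq_succ_le (t : ℕ) (ω : Ω) :
    ∑ n, (S.queue D (t + 1) n ω : ℝ) ^ 2 ≤
      ∑ n, (S.queue D t n ω : ℝ) ^ 2 + (S.A t ω : ℝ) ^ 2 + ∑ n, (S.R t n ω : ℝ) ^ 2 +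
        2 * ((S.queue D t (D t ω) ω : ℝ) * S.A t ω) -
          2 * ∑ n, (S.queue D t n ω : ℝ) * S.R t n ω := by
  refine (Finset.sum_le_sum fun n _ => sq_add_sub_le _ _ _).trans_eq ?_
  rw [Finset.sum_sub_distrib, Finset.sum_add_distrib, Finset.sum_add_distrib,
    Finset.sum_add_distrib, ← Finset.mul_sum, ← Finset.mul_sum]
  simp

theorem sum_age_succ (t : ℕ) (ω : Ω) :
    ∑ n, (S.age D (t + 1) n ω : ℝ) =
      ∑ n, (S.age D t n ω : ℝ) + N -
        ((S.age D t (D t ω) ω : ℝ) + 1) * (if 0 < S.A t ω then 1 else 0) := by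
  by_cases h : 0 < S.A t ω
  · have h1 : ∀ n, (S.age D (t + 1) n ω : ℝ) =
        (S.age D t n ω + 1) - if D t ω = n then ((S.age D t n ω : ℝ) + 1) else 0 := by
      intro n
      simp only [age, h, and_true]
      split_ifs <;> simp
    simp only [h1, Finset.sum_sub_distrib, Finset.sum_add_distrib, if_pos h]
    simp
  · simp [age, h, Finset.sum_add_distrib]

/-- The same system with all initial ages equal to zero. Its ages bound the true ones from below,
and the quadratic comparison function of `le_sum_age` then needs no second moment of the initial
ages. -/
def resetAge (S : CrowdSystem N Ω) : CrowdSystem N Ω := { S with Δ₀ := fun _ _ => 0 }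

theorem resetAge_age_le (t : ℕ) (n : Fin N) (ω : Ω) :
    S.resetAge.age D t n ω ≤ S.age D t n ω := by
  induction t with
  | zero => exact Nat.zero_le _
  | succ t ih =>
    simp only [age, show S.resetAge.A = S.A from rfl]
    split_ifs <;> omega

/-- Sample-path bound: a PoI that is rarely visited is old on average. The parameter `c` plays the
role of the time between visits, and the age is compared with the increments of `x² / 2 - c x`;
at a visit the two sides differ by the square `(x + 1 - c)² / 2`. -/
theorem le_sum_age (c : ℝ) (n : Fin N) (ω : Ω) (T : ℕ) :
    (c - 1 / 2) * T - c ^ 2 / 2 *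
        ∑ t ∈ Finset.range T, (if D t ω = n ∧ 0 < S.A t ω then 1 else 0) - c ^ 2 / 2 ≤
      ∑ t ∈ Finset.range T, (S.age D t n ω : ℝ) := by
  have key : (S.resetAge.age D T n ω : ℝ) ^ 2 / 2 - c * S.resetAge.age D T n ω ≤
      ∑ t ∈ Finset.range T, (S.resetAge.age D t n ω : ℝ) - (c - 1 / 2) * T + c ^ 2 / 2 *
        ∑ t ∈ Finset.range T, (if D t ω = n ∧ 0 < S.A t ω then 1 else 0) := by
    induction T with
    | zero => simp [age, resetAge]
    | succ T ih =>
      rw [Finset.sum_range_succ, Finset.sum_range_succ]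
      simp only [age, show S.resetAge.A = S.A from rfl]
      split_ifs
      · push_cast
        nlinarith [sq_nonneg ((S.resetAge.age D T n ω : ℝ) + 1 - c)]
      · push_cast
        nlinarith
  have h : ∑ t ∈ Finset.range T, (S.resetAge.age D t n ω : ℝ) ≤
      ∑ t ∈ Finset.range T, (S.age D t n ω : ℝ) :=
    Finset.sum_le_sum fun t _ => by exact_mod_cast resetAge_age_le t n ω
  nlinarith [sq_nonneg ((S.resetAge.age D T n ω : ℝ) - c)]

/-- The queue of a single server that pools the services of all PoIs, starts empty, and admits at
most `K` users per slot. The truncation makes all moments finite. -/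
def pooledQueue (S : CrowdSystem N Ω) (K : ℕ) : ℕ → Ω → ℕ
  | 0, _ => 0
  | t + 1, ω => pooledQueue S K t ω + min (S.A t ω) K - ∑ n, S.R t n ω

theorem pooledQueue_le_sum_queue {K : ℕ} (t : ℕ) (ω : Ω) :
    S.pooledQueue K t ω ≤ ∑ n, S.queue D t n ω := by
  induction t with
  | zero => exact Nat.zero_le _
  | succ t ih =>
    have h : ∑ n, (S.queue D t n ω + if D t ω = n then S.A t ω else 0) ≤
        ∑ n, (S.queue D (t + 1) n ω + S.R t n ω) :=
      Finset.sum_le_sum fun n _ => by simp only [queue]; omega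
    rw [Finset.sum_add_distrib, Finset.sum_add_distrib] at h
    simp only [Finset.sum_ite_eq, Finset.mem_univ, if_true] at h
    have := min_le_left (S.A t ω) K
    simp only [pooledQueue]
    omega

theorem pooledQueue_le {K : ℕ} (t : ℕ) (ω : Ω) : S.pooledQueue K t ω ≤ t * K := by
  induction t with
  | zero => simp [pooledQueue]
  | succ t ih =>
    have := min_le_right (S.A t ω) K
    simp only [pooledQueue, add_mul, one_mul]
    omega

/-- The net input of the pooled queue in a slot with arrivals `x.1` and services `x.2`. -/
def netInput (K : ℕ) (x : ℕ × (Fin N → ℕ)) : ℝ := (min x.1 K : ℕ) - ((∑ n, x.2 n : ℕ) : ℝ)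

/-- One-slot lower bound: unused service is at most `L`, and it is positive only if the queue
empties. -/
theorem le_sq_add_sub (x a r : ℕ) {L : ℝ} (hr : (r : ℝ) ≤ L) :
    ((x : ℝ) + ((a : ℝ) - r)) ^ 2 - L * (((x + a - r : ℕ) : ℝ) - x - ((a : ℝ) - r)) ≤
      ((x + a - r : ℕ) : ℝ) ^ 2 := by
  rcases le_total r (x + a) with h | h
  · push_cast [Nat.cast_sub h]
    apply le_of_eq
    ring
  · rw [Nat.sub_eq_zero_of_le h]
    have h' : (x : ℝ) + a ≤ r := by exact_mod_cast h
    have hx : (0 : ℝ) ≤ x := Nat.cast_nonneg _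
    have ha : (0 : ℝ) ≤ a := Nat.cast_nonneg _
    push_cast
    nlinarith

section Probability

variable [mΩ : MeasurableSpace Ω] {P : Measure Ω} {𝓕 : Filtration ℕ mΩ}
  {pmin pmax Rmax β γ ε : ℝ}

/-! ### Measurability, independence and moments -/

namespace IsModel

theorem measurable_A' (hS : S.IsModel P 𝓕 pmin pmax Rmax) (t : ℕ) : Measurable (S.A t) :=
  (hS.measurable_A t).mono (𝓕.le _) le_rfl

theorem measurable_R' (hS : S.IsModel P 𝓕 pmin pmax Rmax) (t : ℕ) (n : Fin N) :
    Measurable (S.R t n) :=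
  (hS.measurable_R t n).mono (𝓕.le _) le_rfl

theorem measurable_queue (hS : S.IsModel P 𝓕 pmin pmax Rmax)
    (hD : ∀ t, Measurable[𝓕 (t + 1)] (D t)) (t : ℕ) (n : Fin N) :
    Measurable[𝓕 t] (S.queue D t n) := by
  induction t with
  | zero => exact hS.measurable_Q₀ n
  | succ t ih =>
    exact (Measurable.of_discrete (f := fun x : ℕ × Fin N × ℕ × ℕ =>
      x.1 + (if x.2.1 = n then x.2.2.1 else 0) - x.2.2.2)).comp
      ((ih.mono (𝓕.mono t.le_succ) le_rfl).prodMk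
        ((hD t).prodMk ((hS.measurable_A t).prodMk (hS.measurable_R t n))))

theorem measurable_age (hS : S.IsModel P 𝓕 pmin pmax Rmax)
    (hD : ∀ t, Measurable[𝓕 (t + 1)] (D t)) (t : ℕ) (n : Fin N) :
    Measurable[𝓕 t] (S.age D t n) := by
  induction t with
  | zero => exact hS.measurable_Δ₀ n
  | succ t ih =>
    have h : Measurable[𝓕 (t + 1)] fun ω => if D t ω = n ∧ 0 < S.A t ω then 0
        else S.age D t n ω + 1 :=
      (Measurable.of_discrete (f := fun x : ℕ × Fin N × ℕ =>
        if x.2.1 = n ∧ 0 < x.2.2 then 0 else x.1 + 1)).comp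
      ((ih.mono (𝓕.mono t.le_succ) le_rfl).prodMk ((hD t).prodMk (hS.measurable_A t)))
    exact h

/-- A function of the arrivals and services of slot `t` is independent of what is known at the
beginning of slot `t`. -/
theorem indepFun_past (hS : S.IsModel P 𝓕 pmin pmax Rmax) (t : ℕ) {α δ : Type*}
    [MeasurableSpace α] [MeasurableSpace δ] {X : Ω → α} (hX : Measurable[𝓕 t] X)
    (g : ℕ × (Fin N → ℕ) → δ) :
    IndepFun X (fun ω => g (S.A t ω, fun n => S.R t n ω)) P := by
  rw [IndepFun_iff_Indep]
  refine (indep_of_indep_of_le_left (indep_of_indep_of_le_right (hS.indep_past t) hX.comap_le)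
    ?_).symm
  have hg : Measurable g := .of_discrete
  exact Measurable.comap_le (hg.comp (comap_measurable _))

theorem integral_mul_past (hS : S.IsModel P 𝓕 pmin pmax Rmax) (t : ℕ) {X : Ω → ℝ}
    (hX : Measurable[𝓕 t] X) (g : ℕ × (Fin N → ℕ) → ℝ) :
    ∫ ω, X ω * g (S.A t ω, fun n => S.R t n ω) ∂P =
      (∫ ω, X ω ∂P) * ∫ ω, g (S.A t ω, fun n => S.R t n ω) ∂P := by
  refine (hS.indepFun_past t hX g).integral_fun_mul_eq_mul_integral
    (hX.mono (𝓕.le t) le_rfl).aestronglyMeasurable ?_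
  have hg : Measurable g := .of_discrete
  exact (hg.comp ((hS.measurable_A' t).prodMk
    (measurable_pi_lambda _ fun n => hS.measurable_R' t n))).aestronglyMeasurable

theorem memLp_A (hS : S.IsModel P 𝓕 pmin pmax Rmax) (t : ℕ) :
    MemLp (fun ω => (S.A t ω : ℝ)) 2 P := by
  have h : MemLp (fun ω => (S.A 0 ω : ℝ)) 2 P :=
    (memLp_two_iff_integrable_sq
      (measurable_from_top.comp (hS.measurable_A' 0)).aestronglyMeasurable).2 hS.sq_integrable_A
  exact (((hS.identDistrib_A t).comp (u := fun k : ℕ => (k : ℝ)) .of_discrete).memLp_iff).2 h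

theorem Rmax_nonneg [IsProbabilityMeasure P] (hS : S.IsModel P 𝓕 pmin pmax Rmax) (n : Fin N) :
    0 ≤ Rmax := by
  obtain ⟨ω, hω⟩ := (hS.R_le 0 n).exists
  exact (Nat.cast_nonneg _).trans hω

theorem memLp_R [IsProbabilityMeasure P] (hS : S.IsModel P 𝓕 pmin pmax Rmax) (t : ℕ) (n : Fin N) :
    MemLp (fun ω => (S.R t n ω : ℝ)) 2 P := by
  refine MemLp.of_bound (measurable_from_top.comp (hS.measurable_R' t n)).aestronglyMeasurable
    Rmax ?_
  filter_upwards [hS.R_le t n] with ω hω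
  rwa [Real.norm_of_nonneg (Nat.cast_nonneg _)]

theorem memLp_queue [IsProbabilityMeasure P] (hS : S.IsModel P 𝓕 pmin pmax Rmax)
    (hD : ∀ t, Measurable[𝓕 (t + 1)] (D t)) (t : ℕ) (n : Fin N) :
    MemLp (fun ω => (S.queue D t n ω : ℝ)) 2 P := by
  have hm : ∀ t, AEStronglyMeasurable (fun ω => (S.queue D t n ω : ℝ)) P := fun t =>
    (measurable_from_top.comp
      ((hS.measurable_queue hD t n).mono (𝓕.le t) le_rfl)).aestronglyMeasurable
  induction t with
  | zero => exact (memLp_two_iff_integrable_sq (hm 0)).2 (hS.sq_integrable_Q₀ n)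
  | succ t ih =>
    refine (ih.add (hS.memLp_A t)).of_le (hm _) (ae_of_all _ fun ω => ?_)
    rw [Pi.add_apply, Real.norm_of_nonneg (by positivity), Real.norm_of_nonneg (by positivity)]
    have : S.queue D (t + 1) n ω ≤ S.queue D t n ω + S.A t ω := by
      simp only [queue]; split_ifs <;> omega
    exact_mod_cast this

theorem integrable_age [IsProbabilityMeasure P] (hS : S.IsModel P 𝓕 pmin pmax Rmax)
    (hD : ∀ t, Measurable[𝓕 (t + 1)] (D t)) (t : ℕ) (n : Fin N) :
    Integrable (fun ω => (S.age D t n ω : ℝ)) P := by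
  refine ((hS.integrable_Δ₀ n).add (integrable_const (t : ℝ))).mono'
    (measurable_from_top.comp
      ((hS.measurable_age hD t n).mono (𝓕.le t) le_rfl)).aestronglyMeasurable
    (ae_of_all _ fun ω => ?_)
  rw [Real.norm_of_nonneg (by positivity)]
  have := age_le (S := S) (D := D) t n ω
  simp only [Pi.add_apply]
  exact_mod_cast this

theorem integral_A (hS : S.IsModel P 𝓕 pmin pmax Rmax) (g : ℕ → ℝ) (t : ℕ) :
    ∫ ω, g (S.A t ω) ∂P = ∫ ω, g (S.A 0 ω) ∂P :=
  ((hS.identDistrib_A t).comp (u := g) .of_discrete).integral_eq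

theorem integral_R (hS : S.IsModel P 𝓕 pmin pmax Rmax) (g : ℕ → ℝ) (t : ℕ) (n : Fin N) :
    ∫ ω, g (S.R t n ω) ∂P = ∫ ω, g (S.R 0 n ω) ∂P :=
  ((hS.identDistrib_R t n).comp (u := g) .of_discrete).integral_eq

theorem record_mem (hS : S.IsModel P 𝓕 pmin pmax Rmax) (t : ℕ) (n : Fin N) :
    ∀ᵐ ω ∂P, S.record D t n ω ∈ Set.Icc pmin pmax := by
  induction t with
  | zero => exact hS.r₀_mem n
  | succ t ih =>
    filter_upwards [ih, hS.p_mem t n] with ω h1 h2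
    simp only [record]
    split_ifs
    exacts [h2, h1]

theorem pmax_pos [IsProbabilityMeasure P] (hS : S.IsModel P 𝓕 pmin pmax Rmax) (n : Fin N) :
    0 < pmax := by
  obtain ⟨ω, hω⟩ := (hS.p_mem 0 n).exists
  exact hS.pmin_pos.trans_le (hω.1.trans hω.2)

theorem muSum_pos (hS : S.IsModel P 𝓕 pmin pmax Rmax) (n : Fin N) : 0 < S.muSum P :=
  Finset.sum_pos (fun n _ => hS.mu_pos n) ⟨n, Finset.mem_univ n⟩

theorem sum_mu_div_muSum (hS : S.IsModel P 𝓕 pmin pmax Rmax) (n : Fin N) :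
    ∑ n, S.mu P n / S.muSum P = 1 := by
  rw [← Finset.sum_div]; exact div_self (hS.muSum_pos n).ne'

theorem integral_busy (hS : S.IsModel P 𝓕 pmin pmax Rmax) (t : ℕ) :
    ∫ ω, (if 0 < S.A t ω then (1 : ℝ) else 0) ∂P = S.q P := by
  rw [hS.integral_A (fun k => if 0 < k then 1 else 0) t, q, ← integral_indicator_one]
  · simp [Set.indicator_apply]
  · exact hS.measurable_A' 0 (.of_discrete (s := {k : ℕ | 0 < k}))

theorem q_le_one [IsProbabilityMeasure P] : S.q P ≤ 1 := measureReal_le_one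

theorem q_pos [IsProbabilityMeasure P] (hS : S.IsModel P 𝓕 pmin pmax Rmax) : 0 < S.q P := by
  refine measureReal_nonneg.lt_of_ne fun h => ?_
  have h0 : P {ω | 0 < S.A 0 ω} = 0 :=
    (measureReal_eq_zero_iff (measure_ne_top P _)).1 h.symm
  have hA : (fun ω => (S.A 0 ω : ℝ)) =ᵐ[P] 0 := by
    filter_upwards [measure_eq_zero_iff_ae_notMem.1 h0] with ω hω
    simpa using hω
  have := hS.arrivalRate_pos
  rw [arrivalRate, integral_congr_ae hA] at this
  simp at this

theorem mu_le_muMax (n : Fin N) : S.mu P n ≤ S.muMax P :=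
  le_ciSup (f := fun n => S.mu P n) (Set.finite_range _).bddAbove n

/-- The choice of a causal policy in slot `t` is known at time `t + 1`. This is all the lower bounds
use about the policy. -/
theorem measurable_policy (hS : S.IsModel P 𝓕 pmin pmax Rmax) (hD : S.IsPolicy 𝓕 D) (t : ℕ) :
    Measurable[𝓕 (t + 1)] (D t) :=
  (hD t).mono (sup_le (𝓕.mono t.le_succ) (hS.measurable_A t).comap_le) le_rfl

end IsModel

/-! ### The cost of a slot as a real number -/

/-- The expected cost of slot `t` as a real number, with Bochner integrals in place of the lower
integrals of `slotCost`. -/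
noncomputable def meanCost (S : CrowdSystem N Ω) (P : Measure Ω) (β γ ε : ℝ) (D : ℕ → Ω → Fin N)
    (t : ℕ) : ℝ :=
  γ * ε / N * ∑ n, ∫ ω, (S.queue D t n ω : ℝ) ∂P +
    β * ∑ n, S.mu P n / S.muSum P * ∫ ω, (S.age D t n ω : ℝ) ∂P

theorem lintegral_natCast {X : Ω → ℕ} (hX : Integrable (fun ω => (X ω : ℝ)) P) :
    ∫⁻ ω, (X ω : ℝ≥0∞) ∂P = ENNReal.ofReal (∫ ω, (X ω : ℝ) ∂P) := by
  rw [ofReal_integral_eq_lintegral_ofReal hX (ae_of_all _ fun ω => Nat.cast_nonneg _)]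
  simp

theorem IsModel.meanCost_nonneg (hS : S.IsModel P 𝓕 pmin pmax Rmax) (hβ : 0 < β) (hγ : 0 < γ)
    (hε : 0 < ε) (t : ℕ) : 0 ≤ S.meanCost P β γ ε D t := by
  have h1 : ∀ n, 0 ≤ ∫ ω, (S.queue D t n ω : ℝ) ∂P := fun n =>
    integral_nonneg fun _ => by positivity
  have h2 : ∀ n, 0 ≤ ∫ ω, (S.age D t n ω : ℝ) ∂P := fun n => integral_nonneg fun _ => by positivity
  have h3 : ∀ n, 0 ≤ S.mu P n / S.muSum P := fun n =>
    div_nonneg (hS.mu_pos n).le (hS.muSum_pos n).le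
  exact add_nonneg (mul_nonneg (by positivity) (Finset.sum_nonneg fun n _ => h1 n))
    (mul_nonneg hβ.le (Finset.sum_nonneg fun n _ => mul_nonneg (h3 n) (h2 n)))

theorem IsModel.slotCost_eq [IsProbabilityMeasure P] (hS : S.IsModel P 𝓕 pmin pmax Rmax)
    (hD : ∀ t, Measurable[𝓕 (t + 1)] (D t)) (hβ : 0 < β) (hγ : 0 < γ) (hε : 0 < ε) (t : ℕ) :
    S.slotCost P β γ ε D t = ENNReal.ofReal (S.meanCost P β γ ε D t) := by
  have h1 : ∀ n, 0 ≤ ∫ ω, (S.queue D t n ω : ℝ) ∂P := fun n =>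
    integral_nonneg fun _ => by positivity
  have h2 : ∀ n, 0 ≤ ∫ ω, (S.age D t n ω : ℝ) ∂P := fun n => integral_nonneg fun _ => by positivity
  have h3 : ∀ n, 0 ≤ S.mu P n / S.muSum P := fun n =>
    div_nonneg (hS.mu_pos n).le (hS.muSum_pos n).le
  rw [slotCost, meanCost, ENNReal.ofReal_add
      (mul_nonneg (by positivity) (Finset.sum_nonneg fun n _ => h1 n))
      (mul_nonneg hβ.le (Finset.sum_nonneg fun n _ => mul_nonneg (h3 n) (h2 n))),
    ENNReal.ofReal_mul (by positivity), ENNReal.ofReal_mul hβ.le,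
    ENNReal.ofReal_sum_of_nonneg fun n _ => h1 n,
    ENNReal.ofReal_sum_of_nonneg fun n _ => mul_nonneg (h3 n) (h2 n)]
  congr 2
  · exact Finset.sum_congr rfl fun n _ =>
      lintegral_natCast ((hS.memLp_queue hD t n).integrable one_le_two)
  · refine Finset.sum_congr rfl fun n _ => ?_
    rw [ENNReal.ofReal_mul (h3 n), lintegral_natCast (hS.integrable_age hD t n)]

theorem IsModel.cost_eq [IsProbabilityMeasure P] (hS : S.IsModel P 𝓕 pmin pmax Rmax)
    (hD : ∀ t, Measurable[𝓕 (t + 1)] (D t)) (hβ : 0 < β) (hγ : 0 < γ) (hε : 0 < ε) :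
    S.cost P β γ ε D = limsup (fun T : ℕ =>
      ENNReal.ofReal ((∑ t ∈ Finset.range T, S.meanCost P β γ ε D t) / T)) atTop := by
  refine limsup_congr ?_
  filter_upwards [eventually_gt_atTop 0] with T hT
  rw [ENNReal.ofReal_div_of_pos (by exact_mod_cast hT), ENNReal.ofReal_natCast,
    ENNReal.ofReal_sum_of_nonneg fun t _ => hS.meanCost_nonneg hβ hγ hε t]
  simp only [hS.slotCost_eq hD hβ hγ hε]

theorem tendsto_const_add_div (a b : ℝ) :
    Tendsto (fun T : ℕ => ENNReal.ofReal (a + b / T)) atTop (𝓝 (ENNReal.ofReal a)) := by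
  refine ENNReal.tendsto_ofReal ?_
  simpa using tendsto_const_nhds.add (tendsto_const_div_atTop_nhds_zero_nat b)

theorem IsModel.cost_le [IsProbabilityMeasure P] (hS : S.IsModel P 𝓕 pmin pmax Rmax)
    (hD : ∀ t, Measurable[𝓕 (t + 1)] (D t)) (hβ : 0 < β) (hγ : 0 < γ) (hε : 0 < ε) {a b : ℝ}
    (h : ∀ T : ℕ, ∑ t ∈ Finset.range T, S.meanCost P β γ ε D t ≤ a * T + b) :
    S.cost P β γ ε D ≤ ENNReal.ofReal a := by
  rw [hS.cost_eq hD hβ hγ hε, ← (tendsto_const_add_div a b).limsup_eq]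
  refine limsup_le_limsup ?_
  filter_upwards [eventually_gt_atTop 0] with T hT
  have hT : (0 : ℝ) < T := by exact_mod_cast hT
  refine ENNReal.ofReal_le_ofReal ?_
  rw [div_le_iff₀ hT, add_mul, div_mul_cancel₀ _ hT.ne']
  exact h T

theorem IsModel.le_cost [IsProbabilityMeasure P] (hS : S.IsModel P 𝓕 pmin pmax Rmax)
    (hD : ∀ t, Measurable[𝓕 (t + 1)] (D t)) (hβ : 0 < β) (hγ : 0 < γ) (hε : 0 < ε) {a b : ℝ}
    (h : ∀ T : ℕ, a * T + b ≤ ∑ t ∈ Finset.range T, S.meanCost P β γ ε D t) :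
    ENNReal.ofReal a ≤ S.cost P β γ ε D := by
  rw [hS.cost_eq hD hβ hγ hε, ← (tendsto_const_add_div a b).limsup_eq]
  refine limsup_le_limsup ?_
  filter_upwards [eventually_gt_atTop 0] with T hT
  have hT : (0 : ℝ) < T := by exact_mod_cast hT
  refine ENNReal.ofReal_le_ofReal ?_
  rw [le_div_iff₀ hT, add_mul, div_mul_cancel₀ _ hT.ne']
  exact h T

/-! ### Drift of the selfish system -/

namespace IsModel

theorem measurable_selected {X : ℕ → Fin N → Ω → ℕ} {t : ℕ}
    (hX : ∀ n, Measurable[𝓕 t] (X t n)) (hD : Measurable[𝓕 t] (D t)) :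
    Measurable[𝓕 t] fun ω => (X t (D t ω) ω : ℝ) :=
  (Measurable.of_discrete (f := fun x : (Fin N → ℕ) × Fin N => (x.1 x.2 : ℝ))).comp
    (((@measurable_pi_iff _ _ _ (𝓕 t) _ _).2 hX).prodMk hD)

theorem integrable_selected {X : ℕ → Fin N → Ω → ℕ} {t : ℕ}
    (hX : ∀ n, Measurable[𝓕 t] (X t n)) (hD : Measurable[𝓕 t] (D t))
    (hi : ∀ n, Integrable (fun ω => (X t n ω : ℝ)) P) :
    Integrable (fun ω => (X t (D t ω) ω : ℝ)) P := by
  refine (integrable_finsetSum Finset.univ fun n _ => hi n).mono'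
    ((measurable_selected hX hD).mono (𝓕.le t) le_rfl).aestronglyMeasurable
    (ae_of_all _ fun ω => ?_)
  rw [Real.norm_of_nonneg (by positivity)]
  exact Finset.single_le_sum (f := fun n => (X t n ω : ℝ)) (fun _ _ => Nat.cast_nonneg _)
    (Finset.mem_univ _)

theorem succ_measurable (hD : ∀ t, Measurable[𝓕 t] (D t)) (t : ℕ) : Measurable[𝓕 (t + 1)] (D t) :=
  (hD t).mono (𝓕.mono t.le_succ) le_rfl

theorem integral_queue_sq_drift [IsProbabilityMeasure P]
    (hS : S.IsModel P 𝓕 pmin pmax Rmax) (hD : ∀ t, Measurable[𝓕 t] (D t)) (t : ℕ) :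
    ∑ n, ∫ ω, (S.queue D (t + 1) n ω : ℝ) ^ 2 ∂P ≤
      ∑ n, ∫ ω, (S.queue D t n ω : ℝ) ^ 2 ∂P + ∫ ω, (S.A 0 ω : ℝ) ^ 2 ∂P +
        ∑ n, ∫ ω, (S.R 0 n ω : ℝ) ^ 2 ∂P +
        2 * ((∫ ω, (S.queue D t (D t ω) ω : ℝ) ∂P) * S.arrivalRate P) -
          2 * ∑ n, (∫ ω, (S.queue D t n ω : ℝ) ∂P) * S.mu P n := by
  have hD' := succ_measurable hD
  have hQm := fun n => hS.measurable_queue hD' t n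
  have hQ := fun t n => hS.memLp_queue hD' t n
  have iQ : ∀ t, Integrable (fun ω => ∑ n, (S.queue D t n ω : ℝ) ^ 2) P := fun t =>
    integrable_finsetSum _ fun n _ => (hQ t n).integrable_sq
  have iA : Integrable (fun ω => (S.A t ω : ℝ) ^ 2) P := (hS.memLp_A t).integrable_sq
  have iR : Integrable (fun ω => ∑ n, (S.R t n ω : ℝ) ^ 2) P :=
    integrable_finsetSum _ fun n _ => (hS.memLp_R t n).integrable_sq
  have iQD := integrable_selected (X := S.queue D) hQm (hD t)
    fun n => (hQ t n).integrable one_le_two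
  have mQD := measurable_selected (X := S.queue D) hQm (hD t)
  have iQA : Integrable (fun ω => (S.queue D t (D t ω) ω : ℝ) * S.A t ω) P :=
    (hS.indepFun_past t mQD (fun x => (x.1 : ℝ))).integrable_mul iQD
      ((hS.memLp_A t).integrable one_le_two)
  have iQR : ∀ n, Integrable (fun ω => (S.queue D t n ω : ℝ) * S.R t n ω) P := fun n =>
    (hQ t n).integrable_mul (hS.memLp_R t n)
  have iS : Integrable (fun ω => ∑ n, (S.queue D t n ω : ℝ) * S.R t n ω) P :=
    integrable_finsetSum _ fun n _ => iQR n
  have key := integral_mono (iQ (t + 1))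
    (((((iQ t).add iA).add iR).add (iQA.const_mul 2)).sub (iS.const_mul 2))
    (sum_queue_sq_succ_le (S := S) (D := D) t)
  rw [integral_sub' ((((iQ t).add iA).add iR).add (iQA.const_mul 2)) (iS.const_mul 2),
    integral_add' (((iQ t).add iA).add iR) (iQA.const_mul 2),
    integral_add' ((iQ t).add iA) iR, integral_add' (iQ t) iA, integral_const_mul,
    integral_const_mul, integral_finsetSum _ fun n _ => (hQ (t + 1) n).integrable_sq,
    integral_finsetSum _ fun n _ => (hQ t n).integrable_sq,
    integral_finsetSum _ fun n _ => (hS.memLp_R t n).integrable_sq,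
    integral_finsetSum _ fun n _ => iQR n,
    hS.integral_mul_past t mQD (fun x => (x.1 : ℝ)), hS.integral_A (fun k => (k : ℝ) ^ 2) t,
    hS.integral_A (fun k => (k : ℝ)) t] at key
  simp only [hS.integral_R (fun k => (k : ℝ) ^ 2) t] at key
  have hmul : ∀ n, ∫ ω, (S.queue D t n ω : ℝ) * S.R t n ω ∂P =
      (∫ ω, (S.queue D t n ω : ℝ) ∂P) * S.mu P n := fun n =>
    (hS.integral_mul_past t (X := fun ω => (S.queue D t n ω : ℝ))
      (measurable_from_top.comp (hQm n)) (fun x => (x.2 n : ℝ))).trans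
      (congrArg _ (hS.integral_R (fun k => (k : ℝ)) t n))
  simp only [hmul] at key
  exact key

theorem integral_age_drift [IsProbabilityMeasure P]
    (hS : S.IsModel P 𝓕 pmin pmax Rmax) (hD : ∀ t, Measurable[𝓕 t] (D t)) (t : ℕ) :
    ∑ n, ∫ ω, (S.age D (t + 1) n ω : ℝ) ∂P =
      ∑ n, ∫ ω, (S.age D t n ω : ℝ) ∂P + N -
        (∫ ω, (S.age D t (D t ω) ω : ℝ) ∂P + 1) * S.q P := by
  have hD' := succ_measurable hD
  have hm := fun n => hS.measurable_age hD' t n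
  have hi := fun t n => hS.integrable_age hD' t n
  have iD := integrable_selected (X := S.age D) hm (hD t) (hi t)
  have mD := measurable_selected (X := S.age D) hm (hD t)
  have iD1 : Integrable (fun ω => (S.age D t (D t ω) ω : ℝ) + 1) P := iD.add (integrable_const 1)
  have mD1 : Measurable[𝓕 t] (fun ω => (S.age D t (D t ω) ω : ℝ) + 1) := mD.add_const 1
  have iV : Integrable (fun ω => ((S.age D t (D t ω) ω : ℝ) + 1) *
      (if 0 < S.A t ω then 1 else 0)) P := by
    refine iD1.mono' (((mD1.mono (𝓕.le t) le_rfl).mul ?_).aestronglyMeasurable)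
      (ae_of_all _ fun ω => ?_)
    · exact (Measurable.of_discrete (f := fun k : ℕ => if 0 < k then (1 : ℝ) else 0)).comp
        (hS.measurable_A' t)
    · rw [Real.norm_of_nonneg (by positivity)]
      split_ifs
      · simp
      · simp; positivity
  have iS : Integrable (fun ω => ∑ n, (S.age D t n ω : ℝ)) P :=
    integrable_finsetSum _ fun n _ => hi t n
  have iSN : Integrable (fun ω => ∑ n, (S.age D t n ω : ℝ) + N) P := iS.add (integrable_const _)
  rw [← integral_finsetSum _ fun n _ => hi (t + 1) n, ← integral_finsetSum _ fun n _ => hi t n]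
  simp only [sum_age_succ]
  rw [integral_sub iSN iV, integral_add iS (integrable_const _),
    hS.integral_mul_past t mD1 (fun x => if 0 < x.1 then (1 : ℝ) else 0), hS.integral_busy,
    integral_add iD (integrable_const _)]
  simp

/-- The presumed benefit of the selected PoI is at least every average of the benefits. The weights
`μ n / μ_Σ` are those of the ages in the cost; the recorded prices contribute at most
`pmax - pmin < pmax`. -/
theorem selfish_average [IsProbabilityMeasure P]
    (hS : S.IsModel P 𝓕 pmin pmax Rmax) (hD : S.IsSelfish P 𝓕 β γ D) (n₀ : Fin N) (t : ℕ) :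
    β * ∑ n, S.mu P n / S.muSum P * ∫ ω, (S.age D t n ω : ℝ) ∂P -
      γ * ∑ n, S.mu P n / S.muSum P * ∫ ω, (S.queue D t n ω : ℝ) ∂P ≤
    β * ∫ ω, (S.age D t (D t ω) ω : ℝ) ∂P - γ * ∫ ω, (S.queue D t (D t ω) ω : ℝ) ∂P + pmax := by
  have hD' := succ_measurable hD.1
  have iQ := fun n => (hS.memLp_queue hD' t n).integrable one_le_two
  have iΔ := fun n => hS.integrable_age hD' t n
  have iQD := integrable_selected (X := S.queue D) (hS.measurable_queue hD' t) (hD.1 t) iQ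
  have iΔD := integrable_selected (X := S.age D) (hS.measurable_age hD' t) (hD.1 t) iΔ
  have h1 : Integrable (fun ω => ∑ n, S.mu P n / S.muSum P * (S.age D t n ω : ℝ)) P :=
    integrable_finsetSum _ fun n _ => (iΔ n).const_mul _
  have h2 : Integrable (fun ω => ∑ n, S.mu P n / S.muSum P * (S.queue D t n ω : ℝ)) P :=
    integrable_finsetSum _ fun n _ => (iQ n).const_mul _
  have hw := hS.sum_mu_div_muSum n₀
  have hpt : (fun ω => β * (∑ n, S.mu P n / S.muSum P * (S.age D t n ω : ℝ)) -
      γ * ∑ n, S.mu P n / S.muSum P * (S.queue D t n ω : ℝ)) ≤ᵐ[P]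
      fun ω => β * (S.age D t (D t ω) ω : ℝ) - γ * (S.queue D t (D t ω) ω : ℝ) + pmax := by
    filter_upwards [hD.2 t, ae_all_iff.2 fun n => hS.record_mem (D := D) t n] with ω hω hr
    have hb : ∀ n, β * (S.age D t n ω : ℝ) - γ * (S.queue D t n ω : ℝ) ≤
        β * (S.age D t (D t ω) ω : ℝ) - γ * (S.queue D t (D t ω) ω : ℝ) + pmax := fun n => by
      have h := hω n
      have h3 := (hr n).2
      have h4 := (hr (D t ω)).1
      have h5 := hS.pmin_pos
      simp only [benefit] at h
      linarith
    calc _ = ∑ n, S.mu P n / S.muSum P *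
          (β * (S.age D t n ω : ℝ) - γ * (S.queue D t n ω : ℝ)) := by
          rw [Finset.mul_sum, Finset.mul_sum, ← Finset.sum_sub_distrib]
          exact Finset.sum_congr rfl fun n _ => by ring
      _ ≤ ∑ n, S.mu P n / S.muSum P *
          (β * (S.age D t (D t ω) ω : ℝ) - γ * (S.queue D t (D t ω) ω : ℝ) + pmax) :=
          Finset.sum_le_sum fun n _ => mul_le_mul_of_nonneg_left (hb n)
            (div_nonneg (hS.mu_pos n).le (hS.muSum_pos n).le)
      _ = _ := by rw [← Finset.sum_mul, hw, one_mul]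
  have key := integral_mono_ae ((h1.const_mul β).sub (h2.const_mul γ))
    (((iΔD.const_mul β).sub (iQD.const_mul γ)).add (integrable_const pmax)) hpt
  rw [integral_sub' (h1.const_mul β) (h2.const_mul γ), integral_add' ((iΔD.const_mul β).sub
    (iQD.const_mul γ)) (integrable_const pmax), integral_sub' (iΔD.const_mul β)
    (iQD.const_mul γ)] at key
  simp only [integral_const_mul] at key
  rw [integral_finsetSum _ fun n _ => (iΔ n).const_mul _,
    integral_finsetSum _ fun n _ => (iQ n).const_mul _] at key
  simpa [integral_const_mul] using key

/-- The Lyapunov function of the selfish system: squared queue lengths plus ages, scaled so that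
the visited PoI contributes `γ E[Q] - β E[Δ]` to its drift, which is the negated presumed benefit
without the recorded price. -/
noncomputable def _root_.CrowdSystem.lyapunov (S : CrowdSystem N Ω) (P : Measure Ω) (β γ : ℝ)
    (D : ℕ → Ω → Fin N) (t : ℕ) : ℝ :=
  γ / (2 * S.arrivalRate P) * ∑ n, ∫ ω, (S.queue D t n ω : ℝ) ^ 2 ∂P +
    β / S.q P * ∑ n, ∫ ω, (S.age D t n ω : ℝ) ∂P

theorem meanCost_add_lyapunov_le [IsProbabilityMeasure P]
    (hS : S.IsModel P 𝓕 pmin pmax Rmax) (hD : S.IsSelfish P 𝓕 β γ D) (n₀ : Fin N)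
    (hε : ∀ n, S.mu P n / S.muSum P + ε / N ≤ S.mu P n / S.arrivalRate P)
    (hβ : 0 < β) (hγ : 0 < γ) (t : ℕ) :
    S.meanCost P β γ ε D t + S.lyapunov P β γ D (t + 1) ≤
      (S.B P γ + β * (N / S.q P - 1) + pmax) + S.lyapunov P β γ D t := by
  have hl := hS.arrivalRate_pos
  have hq := hS.q_pos
  have hQ := mul_le_mul_of_nonneg_left (hS.integral_queue_sq_drift hD.1 t)
    (show 0 ≤ γ / (2 * S.arrivalRate P) by positivity)
  have hA := hS.integral_age_drift hD.1 t
  have hs := hS.selfish_average hD n₀ t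
  have he : ∑ n, (S.mu P n / S.muSum P + ε / N) * ∫ ω, (S.queue D t n ω : ℝ) ∂P ≤
      ∑ n, S.mu P n / S.arrivalRate P * ∫ ω, (S.queue D t n ω : ℝ) ∂P :=
    Finset.sum_le_sum fun n _ => mul_le_mul_of_nonneg_right (hε n)
      (integral_nonneg fun _ => by positivity)
  have he' := mul_le_mul_of_nonneg_left he hγ.le
  have e1 : ∑ n, S.mu P n / S.arrivalRate P * ∫ ω, (S.queue D t n ω : ℝ) ∂P =
      (∑ n, (∫ ω, (S.queue D t n ω : ℝ) ∂P) * S.mu P n) / S.arrivalRate P := by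
    rw [Finset.sum_div]
    exact Finset.sum_congr rfl fun n _ => by ring
  simp only [add_mul, Finset.sum_add_distrib, ← Finset.mul_sum] at he'
  rw [e1] at he'
  simp only [meanCost, lyapunov, B, hA]
  generalize ∑ n, (∫ ω, (S.queue D t n ω : ℝ) ∂P) * S.mu P n = x1 at *
  generalize ∫ ω, (S.queue D t (D t ω) ω : ℝ) ∂P = x2 at *
  generalize ∫ ω, (S.age D t (D t ω) ω : ℝ) ∂P = x3 at *
  generalize ∑ n, S.mu P n / S.muSum P * ∫ ω, (S.age D t n ω : ℝ) ∂P = x4 at *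
  generalize ∑ n, ∫ ω, (S.age D t n ω : ℝ) ∂P = x5 at *
  generalize ∑ n, ∫ ω, (S.queue D t n ω : ℝ) ∂P = x6 at *
  generalize ∑ n, ∫ ω, (S.queue D (t + 1) n ω : ℝ) ^ 2 ∂P = x7 at *
  generalize ∑ n, ∫ ω, (S.queue D t n ω : ℝ) ^ 2 ∂P = x8 at *
  generalize ∫ ω, (S.A 0 ω : ℝ) ^ 2 ∂P = x9 at *
  generalize ∑ n, ∫ ω, (S.R 0 n ω : ℝ) ^ 2 ∂P = x10 at *
  generalize ∑ n, S.mu P n / S.muSum P * ∫ ω, (S.queue D t n ω : ℝ) ∂P = x11 at *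
  generalize S.arrivalRate P = l at *
  generalize S.q P = q at *
  have e2 : γ / (2 * l) * (x8 + x9 + x10 + 2 * (x2 * l) - 2 * x1) =
      γ / (2 * l) * x8 + γ / (2 * l) * (x9 + x10) + γ * x2 - γ * (x1 / l) := by
    field_simp
    ring
  have e3 : β / q * (x5 + N - (x3 + 1) * q) = β / q * x5 + β * (N / q - 1) - β * x3 := by
    field_simp
    ring
  have e4 : γ * ε / N * x6 = γ * (ε / N * x6) := by ring
  rw [e2] at hQ
  rw [e3, e4]
  linarith

/-- Upper bound on the cost of selfish behaviour, by summing the Lyapunov drift. -/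
theorem selfish_cost_le [IsProbabilityMeasure P]
    (hS : S.IsModel P 𝓕 pmin pmax Rmax) (hD : S.IsSelfish P 𝓕 β γ D) (n₀ : Fin N)
    (hε : ∀ n, S.mu P n / S.muSum P + ε / N ≤ S.mu P n / S.arrivalRate P)
    (hβ : 0 < β) (hγ : 0 < γ) (hε0 : 0 < ε) :
    S.cost P β γ ε D ≤ ENNReal.ofReal (S.B P γ + β * (N / S.q P - 1) + pmax) := by
  refine hS.cost_le (succ_measurable hD.1) hβ hγ hε0 (b := S.lyapunov P β γ D 0) fun T => ?_
  have hnn : 0 ≤ S.lyapunov P β γ D T := by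
    have := hS.arrivalRate_pos
    have := hS.q_pos
    have h1 : ∀ n, 0 ≤ ∫ ω, (S.queue D T n ω : ℝ) ^ 2 ∂P := fun n =>
      integral_nonneg fun _ => by positivity
    have h2 : ∀ n, 0 ≤ ∫ ω, (S.age D T n ω : ℝ) ∂P := fun n =>
      integral_nonneg fun _ => by positivity
    exact add_nonneg (mul_nonneg (by positivity) (Finset.sum_nonneg fun n _ => h1 n))
      (mul_nonneg (by positivity) (Finset.sum_nonneg fun n _ => h2 n))
  suffices ∀ T : ℕ, ∑ t ∈ Finset.range T, S.meanCost P β γ ε D t + S.lyapunov P β γ D T ≤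
      (S.B P γ + β * (N / S.q P - 1) + pmax) * T + S.lyapunov P β γ D 0 by
    linarith [this T]
  intro T
  induction T with
  | zero => simp
  | succ T ih =>
    have := hS.meanCost_add_lyapunov_le hD n₀ hε hβ hγ T
    rw [Finset.sum_range_succ]
    push_cast
    linarith

end IsModel

/-! ### Lower bound on the ages -/

/-- Under every policy the weighted average age is asymptotically at least
`μ_Σ / (2 q μ_max) - 1 / 2`: a slot has at most one visit, with probability at most `q`. -/
theorem IsModel.le_sum_integral_age [IsProbabilityMeasure P]
    (hS : S.IsModel P 𝓕 pmin pmax Rmax) (hD : ∀ t, Measurable[𝓕 (t + 1)] (D t)) (n₀ : Fin N)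
    (T : ℕ) :
    (S.muSum P / (2 * S.q P * S.muMax P) - 1 / 2) * T -
        (S.muSum P / (S.q P * S.muMax P)) ^ 2 / 2 ≤
      ∑ t ∈ Finset.range T, ∑ n, S.mu P n / S.muSum P * ∫ ω, (S.age D t n ω : ℝ) ∂P := by
  have hq := hS.q_pos
  have hmax : 0 < S.muMax P := (hS.mu_pos n₀).trans_le (mu_le_muMax n₀)
  have hsum := hS.muSum_pos n₀
  have hw : ∀ n, 0 ≤ S.mu P n / S.muSum P := fun n => div_nonneg (hS.mu_pos n).le hsum.le
  have hi := fun t n => (hS.integrable_age hD t n).const_mul (S.mu P n / S.muSum P)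
  -- for equal service rates this is `N / q`, the mean time between visits if all PoIs are visited
  -- equally often
  set c := S.muSum P / (S.q P * S.muMax P) with hc
  set v : ℕ → Ω → ℝ := fun t ω => if 0 < S.A t ω then 1 else 0 with hv
  have iv : ∀ t, Integrable (v t) P := fun t =>
    Integrable.of_bound ((Measurable.of_discrete (f := fun k : ℕ =>
      if 0 < k then (1 : ℝ) else 0)).comp (hS.measurable_A' t)).aestronglyMeasurable 1
      (ae_of_all _ fun ω => by simp only [hv]; split_ifs <;> simp)
  have hpt : ∀ ω, (c - 1 / 2) * T - c ^ 2 / 2 - c ^ 2 / 2 * (S.muMax P / S.muSum P) *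
        ∑ t ∈ Finset.range T, v t ω ≤
      ∑ t ∈ Finset.range T, ∑ n, S.mu P n / S.muSum P * (S.age D t n ω : ℝ) := by
    intro ω
    have h1 : ∑ n, S.mu P n / S.muSum P * ((c - 1 / 2) * T - c ^ 2 / 2 *
        ∑ t ∈ Finset.range T, (if D t ω = n ∧ 0 < S.A t ω then 1 else 0) - c ^ 2 / 2) ≤
        ∑ n, S.mu P n / S.muSum P * ∑ t ∈ Finset.range T, (S.age D t n ω : ℝ) :=
      Finset.sum_le_sum fun n _ => mul_le_mul_of_nonneg_left (le_sum_age c n ω T) (hw n)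
    have h2 : ∑ n, S.mu P n / S.muSum P *
        ∑ t ∈ Finset.range T, (if D t ω = n ∧ 0 < S.A t ω then (1 : ℝ) else 0) ≤
        S.muMax P / S.muSum P * ∑ t ∈ Finset.range T, v t ω := by
      simp only [Finset.mul_sum]
      rw [Finset.sum_comm]
      refine Finset.sum_le_sum fun t _ => ?_
      by_cases h : 0 < S.A t ω
      · simp only [h, hv]
        simpa using div_le_div_of_nonneg_right (mu_le_muMax (D t ω)) hsum.le
      · simp [h, hv]
    have h3 : ∑ n, S.mu P n / S.muSum P * ((c - 1 / 2) * T - c ^ 2 / 2 *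
        ∑ t ∈ Finset.range T, (if D t ω = n ∧ 0 < S.A t ω then 1 else 0) - c ^ 2 / 2) =
        ((c - 1 / 2) * T - c ^ 2 / 2) - c ^ 2 / 2 * ∑ n, S.mu P n / S.muSum P *
        ∑ t ∈ Finset.range T, (if D t ω = n ∧ 0 < S.A t ω then (1 : ℝ) else 0) := by
      have hone : ∀ x : ℝ, ∑ n, S.mu P n / S.muSum P * x = x := fun x => by
        rw [← Finset.sum_mul, hS.sum_mu_div_muSum n₀, one_mul]
      conv_rhs => rw [← hone ((c - 1 / 2) * T - c ^ 2 / 2), Finset.mul_sum,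
        ← Finset.sum_sub_distrib]
      exact Finset.sum_congr rfl fun n _ => by ring
    have h4 := mul_le_mul_of_nonneg_left h2 (show 0 ≤ c ^ 2 / 2 by positivity)
    rw [h3] at h1
    rw [Finset.sum_comm]
    simp only [Finset.mul_sum] at h1 h4 ⊢
    simp only [mul_assoc] at h1 h4 ⊢
    linarith
  have iV : Integrable (fun ω => ∑ t ∈ Finset.range T, v t ω) P :=
    integrable_finsetSum _ fun t _ => iv t
  have iN : ∀ t, Integrable (fun ω => ∑ n, S.mu P n / S.muSum P * (S.age D t n ω : ℝ)) P :=
    fun t => integrable_finsetSum _ fun n _ => hi t n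
  have key := integral_mono ((integrable_const ((c - 1 / 2) * T - c ^ 2 / 2)).sub
    (iV.const_mul (c ^ 2 / 2 * (S.muMax P / S.muSum P))))
    (integrable_finsetSum (Finset.range T) fun t _ => iN t) hpt
  rw [integral_sub' (integrable_const _) (iV.const_mul _), integral_const_mul,
    integral_finsetSum _ fun t _ => iv t, integral_finsetSum _ fun t _ => iN t] at key
  simp only [hv, hS.integral_busy, fun t => integral_finsetSum Finset.univ fun n _ => hi t n,
    integral_const_mul] at key
  refine le_trans (le_of_eq ?_) key
  simp only [hc, integral_const, probReal_univ, one_smul, Finset.sum_const, Finset.card_range,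
    nsmul_eq_mul]
  field_simp
  ring

/-! ### Lower bound on the total queue length -/

variable {K : ℕ}

namespace IsModel

theorem measurable_pooledQueue (hS : S.IsModel P 𝓕 pmin pmax Rmax) (t : ℕ) :
    Measurable[𝓕 t] (S.pooledQueue K t) := by
  induction t with
  | zero => exact measurable_const
  | succ t ih =>
    exact (Measurable.of_discrete (f := fun x : ℕ × ℕ × (Fin N → ℕ) =>
      x.1 + min x.2.1 K - ∑ n, x.2.2 n)).comp
      ((ih.mono (𝓕.mono t.le_succ) le_rfl).prodMk ((hS.measurable_A t).prodMk
        ((@measurable_pi_iff _ _ _ (𝓕 (t + 1)) _ _).2 (hS.measurable_R t))))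

theorem integrable_comp_pooledQueue [IsProbabilityMeasure P] (hS : S.IsModel P 𝓕 pmin pmax Rmax)
    (t : ℕ) (f : ℕ → ℝ) : Integrable (fun ω => f (S.pooledQueue K t ω)) P := by
  obtain ⟨b, hb⟩ := ((Set.finite_Iic (t * K)).image fun k => ‖f k‖).bddAbove
  exact Integrable.of_bound ((Measurable.of_discrete (f := f)).comp
    ((hS.measurable_pooledQueue t).mono (𝓕.le t) le_rfl)).aestronglyMeasurable b
    (ae_of_all _ fun ω => hb ⟨_, pooledQueue_le t ω, rfl⟩)

theorem abs_netInput_le (hS : S.IsModel P 𝓕 pmin pmax Rmax) (t : ℕ) :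
    ∀ᵐ ω ∂P, ((∑ n, S.R t n ω : ℕ) : ℝ) ≤ N * Rmax ∧
      |netInput K (S.A t ω, fun n => S.R t n ω)| ≤ K + N * Rmax := by
  filter_upwards [ae_all_iff.2 (hS.R_le t)] with ω hω
  have h1 : ((∑ n, S.R t n ω : ℕ) : ℝ) ≤ N * Rmax := by
    push_cast
    refine (Finset.sum_le_sum fun n _ => hω n).trans_eq ?_
    simp
  refine ⟨h1, ?_⟩
  have h2 : ((min (S.A t ω) K : ℕ) : ℝ) ≤ K := by exact_mod_cast min_le_right _ _
  have h3 : (0 : ℝ) ≤ (min (S.A t ω) K : ℕ) := Nat.cast_nonneg _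
  have h4 : (0 : ℝ) ≤ (∑ n, S.R t n ω : ℕ) := Nat.cast_nonneg _
  simp only [netInput]
  rw [abs_le]
  constructor <;> linarith

theorem integrable_comp_netInput [IsProbabilityMeasure P] (hS : S.IsModel P 𝓕 pmin pmax Rmax)
    (t : ℕ) {f : ℝ → ℝ} (hf : Continuous f) :
    Integrable (fun ω => f (netInput K (S.A t ω, fun n => S.R t n ω))) P := by
  obtain ⟨b, hb⟩ := (isCompact_Icc (a := -((K : ℝ) + N * Rmax))
    (b := K + N * Rmax)).exists_bound_of_continuousOn hf.continuousOn
  refine Integrable.of_bound ((hf.measurable.comp (Measurable.of_discrete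
    (f := netInput (N := N) K))).comp ((hS.measurable_A' t).prodMk
    (measurable_pi_lambda _ (hS.measurable_R' t)))).aestronglyMeasurable b ?_
  filter_upwards [hS.abs_netInput_le t] with ω hω
  exact hb _ (abs_le.1 hω.2)

/-- The mean of the truncated arrivals. -/
noncomputable def _root_.CrowdSystem.truncRate (S : CrowdSystem N Ω) (P : Measure Ω) (K : ℕ) : ℝ :=
  ∫ ω, ((min (S.A 0 ω) K : ℕ) : ℝ) ∂P

/-- The second moment of the truncated arrivals. -/
noncomputable def _root_.CrowdSystem.truncSq (S : CrowdSystem N Ω) (P : Measure Ω) (K : ℕ) : ℝ :=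
  ∫ ω, ((min (S.A 0 ω) K : ℕ) : ℝ) ^ 2 ∂P

theorem memLp_min [IsProbabilityMeasure P] (hS : S.IsModel P 𝓕 pmin pmax Rmax) (t : ℕ) :
    MemLp (fun ω => ((min (S.A t ω) K : ℕ) : ℝ)) 2 P :=
  MemLp.of_bound ((Measurable.of_discrete (f := fun k : ℕ => ((min k K : ℕ) : ℝ))).comp
    (hS.measurable_A' t)).aestronglyMeasurable K (ae_of_all _ fun ω => by
      rw [Real.norm_of_nonneg (Nat.cast_nonneg _)]
      exact_mod_cast min_le_right _ _)

theorem memLp_sum_R [IsProbabilityMeasure P] (hS : S.IsModel P 𝓕 pmin pmax Rmax) (t : ℕ) :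
    MemLp (fun ω => ((∑ n, S.R t n ω : ℕ) : ℝ)) 2 P := by
  have h := memLp_finsetSum (μ := P) (p := 2) Finset.univ fun n _ => hS.memLp_R t n
  simpa using h

theorem integral_sum_R [IsProbabilityMeasure P] (hS : S.IsModel P 𝓕 pmin pmax Rmax) (t : ℕ) :
    ∫ ω, ((∑ n, S.R t n ω : ℕ) : ℝ) ∂P = S.muSum P := by
  push_cast
  rw [integral_finsetSum _ fun n _ => (hS.memLp_R t n).integrable one_le_two]
  exact Finset.sum_congr rfl fun n _ => hS.integral_R (fun k => (k : ℝ)) t n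

theorem integral_sum_R_sq [IsProbabilityMeasure P] (hS : S.IsModel P 𝓕 pmin pmax Rmax) (t : ℕ) :
    ∫ ω, ((∑ n, S.R t n ω : ℕ) : ℝ) ^ 2 ∂P =
      ∑ n, variance (fun ω => (S.R 0 n ω : ℝ)) P + S.muSum P ^ 2 := by
  have h1 := variance_eq_sub (hS.memLp_sum_R t)
  rw [hS.integral_sum_R] at h1
  have h2 := IndepFun.variance_sum (μ := P) (s := Finset.univ)
    (X := fun n ω => (S.R t n ω : ℝ)) (fun n _ => hS.memLp_R t n) fun i _ j _ hij =>
      ((hS.indep_R t).indepFun hij).comp (φ := fun k : ℕ => (k : ℝ)) (ψ := fun k : ℕ => (k : ℝ))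
        .of_discrete .of_discrete
  have h3 : ∀ n, variance (fun ω => (S.R t n ω : ℝ)) P = variance (fun ω => (S.R 0 n ω : ℝ)) P :=
    fun n => ((hS.identDistrib_R t n).comp (u := fun k : ℕ => (k : ℝ)) .of_discrete).variance_eq
  have h4 : (∑ n, fun ω => (S.R t n ω : ℝ)) = fun ω => ((∑ n, S.R t n ω : ℕ) : ℝ) := by
    ext ω; simp
  simp only [h3] at h2
  rw [h4, h1] at h2
  simp only [Pi.pow_apply] at h2
  linarith

theorem integral_netInput [IsProbabilityMeasure P] (hS : S.IsModel P 𝓕 pmin pmax Rmax) (t : ℕ) :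
    ∫ ω, netInput K (S.A t ω, fun n => S.R t n ω) ∂P = -(S.muSum P - S.truncRate P K) := by
  simp only [netInput]
  rw [integral_sub ((hS.memLp_min t).integrable one_le_two)
    ((hS.memLp_sum_R t).integrable one_le_two), hS.integral_sum_R,
    hS.integral_A (fun k => ((min k K : ℕ) : ℝ)), truncRate]
  ring

theorem integral_netInput_sq [IsProbabilityMeasure P] (hS : S.IsModel P 𝓕 pmin pmax Rmax)
    (t : ℕ) :
    ∫ ω, netInput K (S.A t ω, fun n => S.R t n ω) ^ 2 ∂P =
      S.truncSq P K - S.truncRate P K ^ 2 + ∑ n, variance (fun ω => (S.R 0 n ω : ℝ)) P +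
        (S.muSum P - S.truncRate P K) ^ 2 := by
  have hA := hS.memLp_min (K := K) t
  have hR := hS.memLp_sum_R t
  have hind : IndepFun (fun ω => ((min (S.A t ω) K : ℕ) : ℝ))
      (fun ω => ((∑ n, S.R t n ω : ℕ) : ℝ)) P :=
    (hS.indep_A_R t).comp (φ := fun k : ℕ => ((min k K : ℕ) : ℝ))
      (ψ := fun f : Fin N → ℕ => ((∑ n, f n : ℕ) : ℝ)) .of_discrete .of_discrete
  have hAR : Integrable (fun ω => ((min (S.A t ω) K : ℕ) : ℝ) * ((∑ n, S.R t n ω : ℕ) : ℝ)) P :=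
    hA.integrable_mul hR
  have h : ∀ ω, netInput K (S.A t ω, fun n => S.R t n ω) ^ 2 =
      (((min (S.A t ω) K : ℕ) : ℝ) ^ 2 + ((∑ n, S.R t n ω : ℕ) : ℝ) ^ 2) -
        2 * (((min (S.A t ω) K : ℕ) : ℝ) * ((∑ n, S.R t n ω : ℕ) : ℝ)) := fun ω => by
    simp only [netInput]; ring
  have hAA : Integrable (fun ω => ((min (S.A t ω) K : ℕ) : ℝ) ^ 2 +
      ((∑ n, S.R t n ω : ℕ) : ℝ) ^ 2) P := hA.integrable_sq.add hR.integrable_sq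
  simp only [h]
  rw [integral_sub hAA (hAR.const_mul 2),
    integral_add hA.integrable_sq hR.integrable_sq, integral_const_mul,
    hind.integral_fun_mul_eq_mul_integral hA.aestronglyMeasurable hR.aestronglyMeasurable,
    hS.integral_sum_R, hS.integral_sum_R_sq, hS.integral_A (fun k => ((min k K : ℕ) : ℝ)),
    hS.integral_A (fun k => ((min k K : ℕ) : ℝ) ^ 2), truncRate, truncSq]
  ring

theorem truncRate_le [IsProbabilityMeasure P] (hS : S.IsModel P 𝓕 pmin pmax Rmax) :
    S.truncRate P K ≤ S.arrivalRate P :=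
  integral_mono ((hS.memLp_min 0).integrable one_le_two)
    ((hS.memLp_A 0).integrable one_le_two) fun ω => by
      simp only [Nat.cast_le]; exact min_le_left _ _

/-- The pooled queue has bounded second moments: its net input is bounded and has negative mean, so
an exponential moment contracts in every slot. -/
theorem exists_integral_pooledQueue_sq_le [IsProbabilityMeasure P]
    (hS : S.IsModel P 𝓕 pmin pmax Rmax) (hload : S.arrivalRate P < S.muSum P) (K : ℕ) :
    ∃ C : ℝ, ∀ t, ∫ ω, (S.pooledQueue K t ω : ℝ) ^ 2 ∂P ≤ C := by
  set δ := S.muSum P - S.truncRate P K with hδ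
  have hδ0 : 0 < δ := by linarith [hS.truncRate_le (K := K)]
  set b : ℝ := K + N * Rmax with hb
  have hmean : ∀ t, ∫ ω, netInput K (S.A t ω, fun n => S.R t n ω) ∂P = -δ :=
    fun t => hS.integral_netInput t
  have hδb : δ ≤ b := by
    have h := norm_integral_le_of_norm_le_const (μ := P)
      (f := fun ω => netInput K (S.A 0 ω, fun n => S.R 0 n ω)) (C := b)
      ((hS.abs_netInput_le 0).mono fun ω hω => hω.2)
    rw [hmean, norm_neg, Real.norm_of_nonneg hδ0.le] at h
    simpa using h
  have hb0 : 0 < b := hδ0.trans_le hδb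
  -- `exp x ≤ 1 + x + x²` for `|x| ≤ 1` bounds the exponential moment of the net input by
  -- `1 - θ δ + θ² b²`, which equals `1 - θ δ / 2` for this choice
  set θ := δ / (2 * b ^ 2) with hθ
  have hθ0 : 0 < θ := by positivity
  have hθb : θ * b ≤ 1 := by
    rw [hθ, div_mul_eq_mul_div, div_le_one (by positivity)]
    nlinarith
  have hθb2 : θ * b ^ 2 = δ / 2 := by rw [hθ]; field_simp
  have hθδ : θ * δ ≤ 1 := (mul_le_mul_of_nonneg_left hδb hθ0.le).trans hθb
  have hstep : ∀ t, ∫ ω, Real.exp (θ * netInput K (S.A t ω, fun n => S.R t n ω)) ∂P ≤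
      1 - θ * δ / 2 := by
    intro t
    have i0 : Integrable (fun ω => netInput K (S.A t ω, fun n => S.R t n ω)) P :=
      hS.integrable_comp_netInput t continuous_id
    have i1 : Integrable (fun ω => 1 + θ ^ 2 * b ^ 2 +
        θ * netInput K (S.A t ω, fun n => S.R t n ω)) P :=
      (integrable_const _).add (i0.const_mul θ)
    refine (integral_mono_ae (hS.integrable_comp_netInput t (f := fun x => Real.exp (θ * x))
      (by fun_prop)) i1 ?_).trans_eq ?_
    · filter_upwards [hS.abs_netInput_le (K := K) t] with ω hω
      have h1 : |θ * netInput K (S.A t ω, fun n => S.R t n ω)| ≤ θ * b := by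
        rw [abs_mul, abs_of_pos hθ0]
        exact mul_le_mul_of_nonneg_left hω.2 hθ0.le
      have h2 := (abs_le.1 (Real.abs_exp_sub_one_sub_id_le (h1.trans hθb))).2
      have h3 := sq_le_sq' (abs_le.1 h1).1 (abs_le.1 h1).2
      nlinarith
    · rw [integral_add (integrable_const _) (i0.const_mul θ), integral_const_mul]
      simp only [hmean, integral_const, probReal_univ, one_smul]
      nlinarith
  have hexp : ∀ t, ∫ ω, Real.exp (θ * S.pooledQueue K t ω) ∂P ≤ 2 / (θ * δ) := by
    intro t
    induction t with
    | zero =>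
      simp only [pooledQueue, Nat.cast_zero, mul_zero, Real.exp_zero, integral_const,
        probReal_univ, one_smul]
      rw [le_div_iff₀ (by positivity)]
      linarith
    | succ t ih =>
      have iX := hS.integrable_comp_netInput (K := K) t (f := fun x => Real.exp (θ * x))
        (by fun_prop)
      have iφ := hS.integrable_comp_pooledQueue (K := K) t (fun k => Real.exp (θ * k))
      have mφ : Measurable[𝓕 t] fun ω => Real.exp (θ * S.pooledQueue K t ω) :=
        (Measurable.of_discrete (f := fun k : ℕ => Real.exp (θ * k))).comp
          (hS.measurable_pooledQueue t)
      have iφX : Integrable (fun ω => Real.exp (θ * S.pooledQueue K t ω) *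
          Real.exp (θ * netInput K (S.A t ω, fun n => S.R t n ω))) P :=
        (hS.indepFun_past t mφ (fun x => Real.exp (θ * netInput K x))).integrable_mul iφ iX
      have h1 : ∫ ω, Real.exp (θ * S.pooledQueue K (t + 1) ω) ∂P ≤
          ∫ ω, (Real.exp (θ * S.pooledQueue K t ω) *
            Real.exp (θ * netInput K (S.A t ω, fun n => S.R t n ω)) + 1) ∂P := by
        refine integral_mono (hS.integrable_comp_pooledQueue (t + 1) fun k => Real.exp (θ * k))
          (iφX.add (integrable_const 1)) fun ω => ?_
        simp only [← Real.exp_add, ← mul_add, netInput, pooledQueue]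
        rcases le_total (∑ n, S.R t n ω) (S.pooledQueue K t ω + min (S.A t ω) K) with hr | hr
        · rw [Nat.cast_sub hr, Nat.cast_add, add_sub_assoc]
          linarith
        · rw [Nat.sub_eq_zero_of_le hr, Nat.cast_zero, mul_zero, Real.exp_zero]
          exact le_add_of_nonneg_left (Real.exp_pos _).le
      rw [integral_add iφX (integrable_const 1),
        hS.integral_mul_past t mφ (fun x => Real.exp (θ * netInput K x))] at h1
      simp only [integral_const, probReal_univ, one_smul] at h1
      have h2 : (∫ ω, Real.exp (θ * S.pooledQueue K t ω) ∂P) *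
          ∫ ω, Real.exp (θ * netInput K (S.A t ω, fun n => S.R t n ω)) ∂P ≤
          2 / (θ * δ) * (1 - θ * δ / 2) :=
        mul_le_mul ih (hstep t) (integral_nonneg fun _ => (Real.exp_pos _).le) (by positivity)
      have h3 : 2 / (θ * δ) * (1 - θ * δ / 2) + 1 = 2 / (θ * δ) := by field_simp; ring
      linarith
  refine ⟨2 / θ ^ 2 * (2 / (θ * δ)), fun t => ?_⟩
  refine (integral_mono (g := fun ω => 2 / θ ^ 2 * Real.exp (θ * S.pooledQueue K t ω))
    (hS.integrable_comp_pooledQueue t fun k => (k : ℝ) ^ 2)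
    ((hS.integrable_comp_pooledQueue t fun k => Real.exp (θ * k)).const_mul (2 / θ ^ 2))
    fun ω => ?_).trans ?_
  · have h := Real.quadratic_le_exp_of_nonneg (x := θ * S.pooledQueue K t ω) (by positivity)
    have h0 : 0 ≤ θ * (S.pooledQueue K t ω : ℝ) := by positivity
    dsimp only
    rw [div_mul_eq_mul_div, le_div_iff₀ (by positivity)]
    nlinarith
  · rw [integral_const_mul]
    exact mul_le_mul_of_nonneg_left (hexp t) (by positivity)

/-- Lower bound on the drift of the squared pooled queue. The unused service `U` of a slot has mean
`E[φ (t + 1)] - E[φ t] + (μ_Σ - λ_K)`, where `φ` is the pooled queue and `λ_K` its truncated arrival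
rate, and `U² ≤ N Rmax U`. -/
theorem le_integral_pooledQueue_sq_succ [IsProbabilityMeasure P]
    (hS : S.IsModel P 𝓕 pmin pmax Rmax) (t : ℕ) :
    ∫ ω, (S.pooledQueue K t ω : ℝ) ^ 2 ∂P -
        2 * (S.muSum P - S.truncRate P K) * ∫ ω, (S.pooledQueue K t ω : ℝ) ∂P +
        (S.truncSq P K - S.truncRate P K ^ 2 + ∑ n, variance (fun ω => (S.R 0 n ω : ℝ)) P +
          (S.muSum P - S.truncRate P K) ^ 2) -
        N * Rmax * (∫ ω, (S.pooledQueue K (t + 1) ω : ℝ) ∂P -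
          ∫ ω, (S.pooledQueue K t ω : ℝ) ∂P + (S.muSum P - S.truncRate P K)) ≤
      ∫ ω, (S.pooledQueue K (t + 1) ω : ℝ) ^ 2 ∂P := by
  set X : Ω → ℝ := fun ω => netInput K (S.A t ω, fun n => S.R t n ω) with hX
  set φ : ℕ → Ω → ℝ := fun t ω => (S.pooledQueue K t ω : ℝ) with hφ
  have i1 : ∀ t, Integrable (φ t) P := fun t => hS.integrable_comp_pooledQueue t fun k => (k : ℝ)
  have i2 : ∀ t, Integrable (fun ω => φ t ω ^ 2) P := fun t =>
    hS.integrable_comp_pooledQueue t fun k => (k : ℝ) ^ 2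
  have iX : Integrable X P := hS.integrable_comp_netInput t continuous_id
  have iX2 : Integrable (fun ω => X ω ^ 2) P :=
    hS.integrable_comp_netInput t (f := fun x => x ^ 2) (by fun_prop)
  have mφ : Measurable[𝓕 t] (φ t) := measurable_from_top.comp (hS.measurable_pooledQueue t)
  have iφX : Integrable (fun ω => φ t ω * X ω) P :=
    (hS.indepFun_past t mφ (netInput K)).integrable_mul (i1 t) iX
  have iS : Integrable (fun ω => φ t ω ^ 2 + 2 * (φ t ω * X ω)) P :=
    (i2 t).add (iφX.const_mul 2)
  have iL : Integrable (fun ω => φ t ω ^ 2 + 2 * (φ t ω * X ω) + X ω ^ 2) P := iS.add iX2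
  have iU' : Integrable (fun ω => φ (t + 1) ω - φ t ω) P := (i1 (t + 1)).sub (i1 t)
  have iU : Integrable (fun ω => φ (t + 1) ω - φ t ω - X ω) P :=
    iU'.sub iX
  have key : ∫ ω, (φ t ω ^ 2 + 2 * (φ t ω * X ω) + X ω ^ 2 -
      N * Rmax * (φ (t + 1) ω - φ t ω - X ω)) ∂P ≤ ∫ ω, φ (t + 1) ω ^ 2 ∂P := by
    refine integral_mono_ae (iL.sub (iU.const_mul _)) (i2 (t + 1)) ?_
    filter_upwards [hS.abs_netInput_le (K := K) t] with ω hω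
    have h := le_sq_add_sub (S.pooledQueue K t ω) (min (S.A t ω) K) _ hω.1
    simp only [hφ, hX, netInput, pooledQueue]
    refine le_trans (le_of_eq ?_) h
    ring
  have hφX : ∫ ω, φ t ω * X ω ∂P = (∫ ω, φ t ω ∂P) * ∫ ω, X ω ∂P :=
    hS.integral_mul_past t mφ (netInput K)
  have hXm : ∫ ω, X ω ∂P = -(S.muSum P - S.truncRate P K) := hS.integral_netInput t
  have hX2 := hS.integral_netInput_sq (K := K) t
  rw [integral_sub iL (iU.const_mul _), integral_add iS iX2,
    integral_add (i2 t) (iφX.const_mul 2), integral_const_mul, integral_const_mul,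
    integral_sub iU' iX, integral_sub (i1 (t + 1)) (i1 t), hφX, hXm,
    hX2] at key
  linarith

/-- Under every policy the average total queue length is asymptotically at least the mean of the
pooled queue, whose bound turns into `N M / ε` as `K → ∞`. -/
theorem exists_le_sum_integral_queue [IsProbabilityMeasure P]
    (hS : S.IsModel P 𝓕 pmin pmax Rmax) (hD : ∀ t, Measurable[𝓕 (t + 1)] (D t)) (n₀ : Fin N)
    (hload : S.arrivalRate P < S.muSum P) (K : ℕ) :
    ∃ C : ℝ, ∀ T : ℕ,
      ((S.truncSq P K - S.truncRate P K ^ 2 + ∑ n, variance (fun ω => (S.R 0 n ω : ℝ)) P +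
          (S.muSum P - S.truncRate P K) ^ 2) / (2 * (S.muSum P - S.truncRate P K)) -
        N * Rmax / 2) * T + C ≤
      ∑ t ∈ Finset.range T, ∑ n, ∫ ω, (S.queue D t n ω : ℝ) ∂P := by
  obtain ⟨C, hC⟩ := hS.exists_integral_pooledQueue_sq_le hload K
  have hδ0 : 0 < S.muSum P - S.truncRate P K := by linarith [hS.truncRate_le (K := K)]
  have hstep := fun t => hS.le_integral_pooledQueue_sq_succ (K := K) t
  have hR : 0 ≤ N * Rmax := mul_nonneg (Nat.cast_nonneg _) (hS.Rmax_nonneg n₀)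
  generalize (S.truncSq P K - S.truncRate P K ^ 2 +
    ∑ n, variance (fun ω => (S.R 0 n ω : ℝ)) P + (S.muSum P - S.truncRate P K) ^ 2) = W at *
  generalize S.muSum P - S.truncRate P K = δ at *
  generalize N * Rmax = L at *
  have hsum : ∀ T : ℕ, (W - L * δ) * T - 2 * δ *
      ∑ t ∈ Finset.range T, ∫ ω, (S.pooledQueue K t ω : ℝ) ∂P ≤
      ∫ ω, (S.pooledQueue K T ω : ℝ) ^ 2 ∂P + L * ∫ ω, (S.pooledQueue K T ω : ℝ) ∂P := by
    intro T
    induction T with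
    | zero => simp [pooledQueue]
    | succ T ih =>
      have := hstep T
      rw [Finset.sum_range_succ]
      push_cast
      linarith
  refine ⟨-((1 + L) * C / (2 * δ)), fun T => ?_⟩
  have h1 : ∫ ω, (S.pooledQueue K T ω : ℝ) ∂P ≤ C := by
    refine (integral_mono (hS.integrable_comp_pooledQueue T fun k => (k : ℝ))
      (hS.integrable_comp_pooledQueue T fun k => (k : ℝ) ^ 2) fun ω => ?_).trans (hC T)
    dsimp only
    exact_mod_cast Nat.le_self_pow two_ne_zero _
  have h2 : ∑ t ∈ Finset.range T, ∫ ω, (S.pooledQueue K t ω : ℝ) ∂P ≤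
      ∑ t ∈ Finset.range T, ∑ n, ∫ ω, (S.queue D t n ω : ℝ) ∂P := by
    refine Finset.sum_le_sum fun t _ => ?_
    have iQ := fun n => (hS.memLp_queue hD t n).integrable one_le_two
    rw [← integral_finsetSum _ fun n _ => iQ n]
    refine integral_mono (hS.integrable_comp_pooledQueue t fun k => (k : ℝ))
      (integrable_finsetSum _ fun n _ => iQ n) fun ω => ?_
    dsimp only
    exact_mod_cast pooledQueue_le_sum_queue t ω
  refine le_trans ?_ h2
  have h3 := hsum T
  have h4 := hC T
  have h5 := mul_le_mul_of_nonneg_left h1 hR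
  have e : (W / (2 * δ) - L / 2) * T + -((1 + L) * C / (2 * δ)) =
      ((W - L * δ) * T - (1 + L) * C) / (2 * δ) := by
    field_simp
    ring
  rw [e, div_le_iff₀ (by positivity)]
  linarith

theorem tendsto_truncRate [IsProbabilityMeasure P] (hS : S.IsModel P 𝓕 pmin pmax Rmax) :
    Tendsto (S.truncRate P) atTop (𝓝 (S.arrivalRate P)) := by
  refine tendsto_integral_of_dominated_convergence (fun ω => (S.A 0 ω : ℝ))
    (fun K => (hS.memLp_min 0).aestronglyMeasurable) ((hS.memLp_A 0).integrable one_le_two)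
    (fun K => ae_of_all _ fun ω => ?_) (ae_of_all _ fun ω => ?_)
  · rw [Real.norm_of_nonneg (Nat.cast_nonneg _)]
    exact_mod_cast min_le_left _ _
  · refine tendsto_const_nhds.congr' ?_
    filter_upwards [eventually_ge_atTop (S.A 0 ω)] with K hK
    rw [min_eq_left hK]

theorem tendsto_truncSq [IsProbabilityMeasure P] (hS : S.IsModel P 𝓕 pmin pmax Rmax) :
    Tendsto (S.truncSq P) atTop (𝓝 (∫ ω, (S.A 0 ω : ℝ) ^ 2 ∂P)) := by
  refine tendsto_integral_of_dominated_convergence (fun ω => (S.A 0 ω : ℝ) ^ 2)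
    (fun K => (hS.memLp_min 0).integrable_sq.aestronglyMeasurable) hS.sq_integrable_A
    (fun K => ae_of_all _ fun ω => ?_) (ae_of_all _ fun ω => ?_)
  · rw [Real.norm_of_nonneg (by positivity)]
    gcongr
    exact min_le_left _ _
  · refine tendsto_const_nhds.congr' ?_
    filter_upwards [eventually_ge_atTop (S.A 0 ω)] with K hK
    rw [min_eq_left hK]

/-- Lower bound on the cost of every policy. -/
theorem le_policy_cost [IsProbabilityMeasure P]
    (hS : S.IsModel P 𝓕 pmin pmax Rmax) (hD : ∀ t, Measurable[𝓕 (t + 1)] (D t)) (n₀ : Fin N)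
    (hload : S.arrivalRate P < S.muSum P) (hβ : 0 < β) (hγ : 0 < γ) (hε : 0 < ε) :
    ENNReal.ofReal (γ * S.M P ε Rmax + β * (S.muSum P / (2 * S.q P * S.muMax P) - 1 / 2)) ≤
      S.cost P β γ ε D := by
  have hN : (0 : ℝ) < N := by exact_mod_cast n₀.pos
  have hδ : S.muSum P - S.arrivalRate P ≠ 0 := by linarith
  have hlim : Tendsto (fun K => γ * ε / N *
      ((S.truncSq P K - S.truncRate P K ^ 2 + ∑ n, variance (fun ω => (S.R 0 n ω : ℝ)) P +
          (S.muSum P - S.truncRate P K) ^ 2) / (2 * (S.muSum P - S.truncRate P K)) -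
        N * Rmax / 2) + β * (S.muSum P / (2 * S.q P * S.muMax P) - 1 / 2)) atTop
      (𝓝 (γ * S.M P ε Rmax + β * (S.muSum P / (2 * S.q P * S.muMax P) - 1 / 2))) := by
    have h1 := hS.tendsto_truncRate
    have h2 := hS.tendsto_truncSq
    have h3 : Tendsto (fun K => S.muSum P - S.truncRate P K) atTop
        (𝓝 (S.muSum P - S.arrivalRate P)) := tendsto_const_nhds.sub h1
    have hvar := variance_eq_sub (hS.memLp_A 0)
    simp only [Pi.pow_apply] at hvar
    have h4 := (((((((h2.sub (h1.pow 2)).add_const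
      (∑ n, variance (fun ω => (S.R 0 n ω : ℝ)) P)).add (h3.pow 2)).div (h3.const_mul 2)
      (mul_ne_zero two_ne_zero hδ)).sub_const (N * Rmax / 2)).const_mul (γ * ε / N)).add_const
      (β * (S.muSum P / (2 * S.q P * S.muMax P) - 1 / 2)))
    have hM : γ * S.M P ε Rmax = γ * ε / N * ((∫ ω, (S.A 0 ω : ℝ) ^ 2 ∂P -
        S.arrivalRate P ^ 2 + ∑ n, variance (fun ω => (S.R 0 n ω : ℝ)) P +
        (S.muSum P - S.arrivalRate P) ^ 2) / (2 * (S.muSum P - S.arrivalRate P)) -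
        N * Rmax / 2) := by
      rw [CrowdSystem.M, hvar, show (∫ ω, (S.A 0 ω : ℝ) ∂P) = S.arrivalRate P from rfl]
      field_simp
    rw [hM]
    exact h4
  refine le_of_tendsto' (ENNReal.tendsto_ofReal hlim) fun K => ?_
  obtain ⟨C, hC⟩ := hS.exists_le_sum_integral_queue hD n₀ hload K
  refine hS.le_cost hD hβ hγ hε
    (b := γ * ε / N * C - β * ((S.muSum P / (S.q P * S.muMax P)) ^ 2 / 2)) fun T => ?_
  have h1 := mul_le_mul_of_nonneg_left (hC T) (show 0 ≤ γ * ε / N by positivity)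
  have h2 := mul_le_mul_of_nonneg_left (hS.le_sum_integral_age hD n₀ T) hβ.le
  simp only [meanCost, Finset.sum_add_distrib, ← Finset.mul_sum]
  linarith

/-- The contribution of the ages alone to the cost of a policy. -/
theorem age_le_cost [IsProbabilityMeasure P]
    (hS : S.IsModel P 𝓕 pmin pmax Rmax) (hD : ∀ t, Measurable[𝓕 (t + 1)] (D t)) (n₀ : Fin N)
    (hβ : 0 < β) (hγ : 0 < γ) (hε : 0 < ε) :
    ENNReal.ofReal (β * (S.muSum P / (2 * S.q P * S.muMax P) - 1 / 2)) ≤ S.cost P β γ ε D := by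
  refine hS.le_cost hD hβ hγ hε
    (b := -(β * ((S.muSum P / (S.q P * S.muMax P)) ^ 2 / 2))) fun T => ?_
  have h2 := mul_le_mul_of_nonneg_left (hS.le_sum_integral_age hD n₀ T) hβ.le
  have h3 : 0 ≤ γ * ε / N * ∑ t ∈ Finset.range T, ∑ n, ∫ ω, (S.queue D t n ω : ℝ) ∂P :=
    mul_nonneg (by positivity) (Finset.sum_nonneg fun t _ => Finset.sum_nonneg fun n _ =>
      integral_nonneg fun _ => by positivity)
  simp only [meanCost, Finset.sum_add_distrib, ← Finset.mul_sum]
  linarith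

/-! ### The price of anarchy -/

theorem muMax_le_muSum (hS : S.IsModel P 𝓕 pmin pmax Rmax) (n₀ : Fin N) :
    S.muMax P ≤ S.muSum P :=
  have : Nonempty (Fin N) := ⟨n₀⟩
  ciSup_le fun n => Finset.single_le_sum (fun m _ => (hS.mu_pos m).le) (Finset.mem_univ n)

theorem muMax_lt_muSum (hS : S.IsModel P 𝓕 pmin pmax Rmax) (hN : 2 ≤ N) :
    S.muMax P < S.muSum P := by
  have : Nontrivial (Fin N) := Fin.nontrivial_iff_two_le.2 hN
  obtain ⟨n, hn⟩ := exists_eq_ciSup_of_finite (f := fun n => S.mu P n)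
  obtain ⟨m, hm⟩ := exists_ne n
  rw [muMax, ← hn]
  exact Finset.single_lt_sum hm (Finset.mem_univ n) (Finset.mem_univ m) (hS.mu_pos m)
    fun k _ _ => (hS.mu_pos k).le

theorem cost_ne_zero [IsProbabilityMeasure P]
    (hS : S.IsModel P 𝓕 pmin pmax Rmax) (hD : ∀ t, Measurable[𝓕 (t + 1)] (D t)) (n₀ : Fin N)
    (hβ : 0 < β) (hγ : 0 < γ) (hε : 0 < ε) (h : 2 ≤ N ∨ S.q P < 1) :
    S.cost P β γ ε D ≠ 0 := by
  refine (lt_of_lt_of_le (ENNReal.ofReal_pos.2 (mul_pos hβ (sub_pos.2 ?_)))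
    (hS.age_le_cost hD n₀ hβ hγ hε)).ne'
  have hq := hS.q_pos
  have hmax : 0 < S.muMax P := (hS.mu_pos n₀).trans_le (mu_le_muMax n₀)
  rw [div_lt_div_iff₀ two_pos (by positivity)]
  suffices S.q P * S.muMax P < S.muSum P by linarith
  rcases h with h | h
  · exact (mul_le_of_le_one_left hmax.le q_le_one).trans_lt (hS.muMax_lt_muSum h)
  · exact (mul_lt_of_lt_one_left hmax h).trans_le (hS.muMax_le_muSum n₀)

theorem B_nonneg (hS : S.IsModel P 𝓕 pmin pmax Rmax) (hγ : 0 < γ) : 0 ≤ S.B P γ := by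
  have := hS.arrivalRate_pos
  have h : 0 ≤ ∑ n, ∫ ω, (S.R 0 n ω : ℝ) ^ 2 ∂P :=
    Finset.sum_nonneg fun n _ => integral_nonneg fun _ => by positivity
  exact mul_nonneg (by positivity) (add_nonneg (integral_nonneg fun _ => by positivity) h)

theorem one_le_div_q [IsProbabilityMeasure P] (hS : S.IsModel P 𝓕 pmin pmax Rmax)
    (n₀ : Fin N) : 1 ≤ N / S.q P := by
  rw [one_le_div hS.q_pos]
  exact (q_le_one (S := S) (P := P)).trans (by exact_mod_cast n₀.pos)

theorem poa_le_poaBound [IsProbabilityMeasure P]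
    (hS : S.IsModel P 𝓕 pmin pmax Rmax) (hload : S.arrivalRate P < S.muSum P) (n₀ : Fin N)
    (hε0 : 0 < ε) (hε : ∀ n, S.mu P n / S.muSum P + ε / N ≤ S.mu P n / S.arrivalRate P)
    (hβ : 0 < β) (hγ : 0 < γ) (hD : S.IsSelfish P 𝓕 β γ D) :
    S.poa P 𝓕 β γ ε D ≤ S.poaBound P pmax Rmax ε γ β := by
  set C := S.B P γ + β * (N / S.q P - 1) + pmax with hC
  set Y := γ * S.M P ε Rmax + β * (S.muSum P / (2 * S.q P * S.muMax P) - 1 / 2) with hY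
  have hC0 : 0 < C := by
    have h1 := hS.B_nonneg hγ
    have h2 := mul_nonneg hβ.le (sub_nonneg.2 (hS.one_le_div_q n₀))
    have h3 := hS.pmax_pos n₀
    linarith
  have hbound : S.poaBound P pmax Rmax ε γ β = 1 - Y / C := by
    rw [poaBound, ← hC, ← add_div, one_sub_div hC0.ne', hY, hC,
      show ∑ n, S.mu P n = S.muSum P from rfl]
    congr 1
    have hq := hS.q_pos
    have hmax : 0 < S.muMax P := (hS.mu_pos n₀).trans_le (mu_le_muMax n₀)
    field_simp
    ring
  have hJC : S.cost P β γ ε D ≤ ENNReal.ofReal C := hS.selfish_cost_le hD n₀ hε hβ hγ hε0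
  have hOJ : S.optCost P 𝓕 β γ ε ≤ S.cost P β γ ε D :=
    iInf₂_le D fun t => (hD.1 t).mono le_sup_left le_rfl
  have hYO : ENNReal.ofReal Y ≤ S.optCost P 𝓕 β γ ε :=
    le_iInf₂ fun D' hD' => hS.le_policy_cost (hS.measurable_policy hD') n₀ hload hβ hγ hε0
  have hJ : S.cost P β γ ε D ≠ ⊤ := (hJC.trans_lt ENNReal.ofReal_lt_top).ne
  have hJ' : (S.cost P β γ ε D).toReal ≤ C := ENNReal.toReal_le_of_le_ofReal hC0.le hJC
  have hY' : Y ≤ (S.optCost P 𝓕 β γ ε).toReal :=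
    (ENNReal.ofReal_le_iff_le_toReal (ne_top_of_le_ne_top hJ hOJ)).1 hYO
  have hO' : (S.optCost P 𝓕 β γ ε).toReal ≤ (S.cost P β γ ε D).toReal :=
    ENNReal.toReal_mono hJ hOJ
  rw [hbound, poa]
  refine sub_le_sub_left ?_ 1
  rcases le_total Y 0 with h0 | h0
  · exact (div_nonpos_of_nonpos_of_nonneg h0 hC0.le).trans (by positivity)
  rcases (ENNReal.toReal_nonneg (a := S.cost P β γ ε D)).eq_or_lt with hz | hz
  -- a vanishing cost forces `Y = 0`, so the junk value of the quotient is harmless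
  · rw [show Y = 0 by linarith, zero_div]
    positivity
  · exact div_le_div₀ (h0.trans hY') hY' hz hJ'

theorem tendsto_poaBound [IsProbabilityMeasure P]
    (hS : S.IsModel P 𝓕 pmin pmax Rmax) (n₀ : Fin N) (hμ : ∀ m n, S.mu P m = S.mu P n)
    (h : 2 ≤ N ∨ S.q P < 1) :
    Tendsto (fun β : ℝ => S.poaBound P pmax Rmax ε γ β) atTop (𝓝 (1 / 2)) := by
  have hq := hS.q_pos
  have hN : (1 : ℝ) ≤ N := by exact_mod_cast n₀.pos
  have ha : 0 < N / S.q P - 1 := by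
    rw [sub_pos, one_lt_div hq]
    rcases h with h | h
    · have : (2 : ℝ) ≤ N := by exact_mod_cast h
      linarith [q_le_one (S := S) (P := P)]
    · linarith
  have hmax : S.muMax P = S.mu P n₀ := by
    have : Nonempty (Fin N) := ⟨n₀⟩
    rw [muMax]
    simp only [fun n => hμ n n₀, ciSup_const]
  have hsum : ∑ n, S.mu P n = N * S.mu P n₀ := by
    simp only [fun n => hμ n n₀, Finset.sum_const, Finset.card_univ, Fintype.card_fin,
      nsmul_eq_mul]
  have hnum : N / S.q P - 1 / (2 * S.q P * S.muMax P) * ∑ n, S.mu P n - 1 / 2 =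
      (N / S.q P - 1) / 2 := by
    have := hS.mu_pos n₀
    rw [hmax, hsum]
    field_simp
    ring
  simp only [poaBound, hnum]
  generalize (N / S.q P - 1 : ℝ) = a at *
  generalize S.B P γ - γ * S.M P ε Rmax + pmax = x
  generalize S.B P γ = y
  have hlin : Tendsto (fun β : ℝ => y + β * a + pmax) atTop atTop :=
    tendsto_atTop_add_const_right _ _
      (tendsto_atTop_add_const_left _ _ (tendsto_id.atTop_mul_const ha))
  have h1 : Tendsto (fun β : ℝ => (x - (y + pmax) / 2) / (y + β * a + pmax) + 1 / 2) atTop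
      (𝓝 (0 + 1 / 2)) := (hlin.const_div_atTop _).add_const _
  rw [zero_add] at h1
  refine h1.congr' ?_
  filter_upwards [hlin.eventually_gt_atTop 0] with β hβ
  field_simp
  ring

theorem exists_slack [IsProbabilityMeasure P]
    (hS : S.IsModel P 𝓕 pmin pmax Rmax) (hload : S.arrivalRate P < S.muSum P) (n₀ : Fin N) :
    ∃ ε : ℝ, 0 < ε ∧ ∀ n, S.mu P n / S.muSum P + ε / N ≤ S.mu P n / S.arrivalRate P := by
  have : Nonempty (Fin N) := ⟨n₀⟩
  have hN : (0 : ℝ) < N := by exact_mod_cast n₀.pos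
  obtain ⟨m, hm⟩ := Finite.exists_min fun n => S.mu P n / S.arrivalRate P - S.mu P n / S.muSum P
  refine ⟨N * (S.mu P m / S.arrivalRate P - S.mu P m / S.muSum P), mul_pos hN (sub_pos.2 ?_),
    fun n => ?_⟩
  · exact div_lt_div_of_pos_left (hS.mu_pos m) hS.arrivalRate_pos hload
  · rw [mul_div_cancel_left₀ _ hN.ne']
    linarith [hm n]

end IsModel

end Probability

end CrowdSystem

theorem theorem2 {N : ℕ} {Ω : Type*} [mΩ : MeasurableSpace Ω] (P : Measure Ω)
    [IsProbabilityMeasure P] (𝓕 : Filtration ℕ mΩ) (S : CrowdSystem N Ω) (pmin pmax Rmax : ℝ)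
    (hS : S.IsModel P 𝓕 pmin pmax Rmax) (hload : S.arrivalRate P < S.muSum P) :
    (∃ ε : ℝ, 0 < ε ∧
      ∀ n, S.mu P n / S.muSum P + ε / N ≤ S.mu P n / S.arrivalRate P) ∧
    ∀ ε : ℝ, 0 < ε →
      (∀ n, S.mu P n / S.muSum P + ε / N ≤ S.mu P n / S.arrivalRate P) →
      ∀ γ : ℝ, 0 < γ →
        (∀ β : ℝ, 0 < β → ∀ D : ℕ → Ω → Fin N, S.IsSelfish P 𝓕 β γ D →
          S.cost P β γ ε D ≠ ⊤ ∧
          (2 ≤ N ∨ S.q P < 1 → S.cost P β γ ε D ≠ 0) ∧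
          S.poa P 𝓕 β γ ε D ≤
            S.poaBound P pmax Rmax ε γ β) ∧
        ((∀ m n, S.mu P m = S.mu P n) → (2 ≤ N ∨ S.q P < 1) →
          Tendsto (fun β : ℝ => S.poaBound P pmax Rmax ε γ β) atTop (𝓝 (1 / 2))) := by
  have hN : Nonempty (Fin N) := by
    by_contra h
    have h0 : S.muSum P = 0 := by
      rw [not_nonempty_iff] at h
      simp [CrowdSystem.muSum]
    linarith [hS.arrivalRate_pos]
  obtain ⟨n₀⟩ := hN
  refine ⟨hS.exists_slack hload n₀, fun ε hε0 hε γ hγ => ⟨fun β hβ D hD => ⟨?_, ?_, ?_⟩, ?_⟩⟩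
  · exact ((hS.selfish_cost_le hD n₀ hε hβ hγ hε0).trans_lt ENNReal.ofReal_lt_top).ne
  · exact hS.cost_ne_zero (CrowdSystem.IsModel.succ_measurable hD.1) n₀ hβ hγ hε0
  · exact hS.poa_le_poaBound hload n₀ hε0 hε hβ hγ hD
  · exact hS.tendsto_poaBound n₀
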